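/- **Setting.** For a finite simple graph $G$ on $N$ and $K\subseteq N$ let $\mathrm{Odd}(K)$ be the set of vertices with an odd number of neighbours in $K$. A labelled open graph is $(G,I,O,\lambda,\alpha)$ with $I,O\subseteq N$, $\lambda:N\setminus O\to\{XY,XZ,YZ,X,Y,Z\}$ and real angles $\alpha$ on $N\setminus O$ (ignored for the labels $X,Y,Z$). Its target linear map is $\bigl(\prod_{i\notin O}\langle +_{\lambda(i),\alpha(i)}|_i\bigr)\,E_G\,N_{I^c}$, where $N_{I^c}$ prepares the non-inputs in $|+\rangle$, $E_G$ applies $CZ$ along every edge, $|\pm_{XY,\alpha}\rangle=\tfrac1{\sqrt2}(|0\rangle\pm e^{i\alpha}|1\rangle)$, $|\pm_{YZ,\alpha}\rangle=\tfrac1{\sqrt2}(|+\rangle\pm e^{i\alpha}|-\rangle)$, $|\pm_{XZ,\alpha}\rangle=\tfrac1{\sqrt2}(|i\rangle\pm e^{i\alpha}|{-i}\rangle)$, and $X,Y,Z$ denote the Pauli bases. A *Pauli flow* is a pair $(p,<)$ of a map $p$ from $N\setminus O$ to subsets of $N\setminus I$ and a strict partial order $<$ on $N$ such that for all $v\notin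 O$ and $w\ne v$ (an output has no label): 1. if $w\in p(v)$ and $\lambda(w)\notin\{X,Y\}$, then $v<w$; 2. if $w\in\mathrm{Odd}(p(v))$ and $\lambda(w)\notin\{Y,Z\}$, then $v<w$; 3. if $\lambda(w)=Y$ and not $v<w$, then $w\in p(v)\iff w\in\mathrm{Odd}(p(v))$; and $v\notin p(v)$, $v\in\mathrm{Odd}(p(v))$ if $\lambda(v)=XY$; $v\in p(v)$, $v\in\mathrm{Odd}(p(v))$ if $\lambda(v)=XZ$; $v\in p(v)$, $v\notin\mathrm{Odd}(p(v))$ if $\lambda(v)=YZ$; $v\in\mathrm{Odd}(p(v))$ if $\lambda(v)=X$; $v\in p(v)$ if $\lambda(v)=Z$; exactly one of $v\in p(v)$, $v\in\mathrm{Odd}(p(v))$ if $\lambda(v)=Y$. An *XY-fusion network* $\mathcal F=(G,I,O,F,\lambda,\alpha)$ consists of a finite graph $G$ on $V$, sets $I,O\subseteq V$, a finite multiset $F$ of pairs of distinct vertices of $V\setminus O$ (fusions), labels $\lambda(v)\in\{XY,XZ,YZ,X,Y,Z\}$ and angles $\alpha(v)$ for $v\in V\setminus O$, and labels $\lambda(f)\in\{X,Y\}$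 for $f\in F$. Its *target open graph* $\mathcal M_{\mathcal F}$ is obtained by adding for each $f\in F$ a new vertex, also called $f$, adjacent to the two vertices of $f$ and labelled $\lambda(f)$; $T(\mathcal F)$ is the target linear map of $\mathcal M_{\mathcal F}$. An *XY-flow* for $\mathcal F$ is a Pauli flow $(p,<)$ on $\mathcal M_{\mathcal F}$ for which no corrections are needed on fusion nodes: for every $f\in F$ and every non-output $v\neq f$ of $\mathcal M_{\mathcal F}$, if $\lambda(f)=X$ then $f\notin\mathrm{Odd}(p(v))$, and if $\lambda(f)=Y$ then $f\in p(v)\iff f\in\mathrm{Odd}(p(v))$. A *pattern* is a sequence of preparations $N_i$ of $|+\rangle$, gates $E_{ij}=CZ_{ij}$, fusions $F_{ij}^{\lambda}$, destructive measurements $M_i^{\lambda,\alpha}$ and Pauli corrections $X_j^{t},Z_j^{t}$, with $t$ a sum modulo 2 of outcomes. On success, a fusion with outcome $k$ acts as $\frac12(1+(-1)^kZ_iZ_j)$ if $\lambda=X$, and as $\frac12(1-(-1)^k i\,Z_iZ_j)$ if $\lambda=Y$. The *success branches* are the linear maps obtained by fixing all outcomes, every fusion being successful. On success, a pattern is *deterministic*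 if its success branches are non-zero multiples of each other, *strongly deterministic* if they are equal up to phases, *uniformly deterministic* if it is deterministic for all values of the measurement angles, and *stepwise deterministic* if, for every single-qubit measurement command, the pattern truncated after that command and completed by the later corrections depending on its outcome is deterministic. It is *runnable* if no command acts on a qubit already measured or not yet prepared, no correction depends on an outcome not yet known, and exactly the non-outputs are measured. **Theorem.** Let $\mathcal F$ be an XY-fusion network with XY-flow $(p,<)$. Enumerate $F$ in any order, and $V\setminus O$ in any order compatible with $<$. For $i\in V\setminus O$ let $L(i)\subseteq V$ consist of $O$ and the elements of $V\setminus O$ enumerated after $i$; for $f\in F$ let $L(f)=V$. For $u\in (V\setminus O)\cup F$ put $$C_u=X^{k_u}_{p(u)\cap L(u)}\;Z^{k_u}_{\mathrm{Odd}(p(u))\cap L(u)},$$ where $k_u$ is the outcome at $u$ and $\mathrm{Odd}$ is taken in $\mathcal M_{\mathcal F}$. Then the XY-fusion pattern (commands executed from right to left, products in the chosen orders) $$\Bigl(\prod_{i\in V\setminus O} C_i\,M_i^{\lambda(i),\alpha(i)}\Bigr)\Bigl(\prod_{f\in F}C_f\Bigr)\Bigl(\prod_{f=\{i,j\}\in F}F_{ij}^{\lambda(f)}\Bigr)E_G\,N_{I^c}$$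 is runnable and uniformly, strongly and stepwise deterministic on success, and it implements $T(\mathcal F)$ when all fusions are successful: every success branch is a non-zero multiple of $T(\mathcal F)$. If moreover $g\notin p(f)$ whenever $g$ is a Y-fusion enumerated after the fusion $f$, then the same holds for the pattern in which each fusion is directly followed by its corrections, that is, with $\prod_{f=\{i,j\}\in F}C_f\,F_{ij}^{\lambda(f)}$ in place of the two products over $F$. -/

import Mathlib

noncomputable section

namespace XYFusion

open Matrix

/-! ### Measurement labels and their bases -/

/-- Measurement planes `XY`, `XZ`, `YZ` and Pauli measurements `X`, `Y`, `Z`. -/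
inductive MeasLabel
  | XY | XZ | YZ | X | Y | Z

/-- The two kinds of fusion. -/
inductive FusionLabel
  | X | Y

def FusionLabel.toMeas : FusionLabel → MeasLabel
  | .X => .X
  | .Y => .Y

/-- The sign `(-1)^k` of an outcome `k`. -/
def sgn (k : ZMod 2) : ℂ := if k = 0 then 1 else -1

def rsqrt2 : ℂ := ((Real.sqrt 2 : ℝ) : ℂ)⁻¹

def ket0 : Fin 2 → ℂ := ![1, 0]
def ket1 : Fin 2 → ℂ := ![0, 1]
/-- `|+⟩` for `k = 0`, `|-⟩` for `k = 1`. -/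
def ketX (k : ZMod 2) : Fin 2 → ℂ := rsqrt2 • (ket0 + sgn k • ket1)
/-- `|i⟩` for `k = 0`, `|-i⟩` for `k = 1`. -/
def ketY (k : ZMod 2) : Fin 2 → ℂ := rsqrt2 • (ket0 + (sgn k * Complex.I) • ket1)
/-- `|0⟩` for `k = 0`, `|1⟩` for `k = 1`. -/
def ketZ (k : ZMod 2) : Fin 2 → ℂ := if k = 0 then ket0 else ket1

/-- `e^{iα}`. -/
def phase (α : ℝ) : ℂ := Complex.exp (Complex.I * (α : ℂ))

/-- The basis vector `|±_{λ,α}⟩` belonging to outcome `k` (`+` for `k = 0`, `-` for `k = 1`).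
The angle plays no role for the Pauli labels. -/
def measKet (l : MeasLabel) (α : ℝ) (k : ZMod 2) : Fin 2 → ℂ :=
  match l with
  | .XY => rsqrt2 • (ket0 + (sgn k * phase α) • ket1)
  | .YZ => rsqrt2 • (ketX 0 + (sgn k * phase α) • ketX 1)
  | .XZ => rsqrt2 • (ketY 0 + (sgn k * phase α) • ketY 1)
  | .X => ketX k
  | .Y => ketY k
  | .Z => ketZ k

/-- `⟨±_{λ,α}|` as a row vector in the computational basis. -/
def measBra (l : MeasLabel) (α : ℝ) (k : ZMod 2) : Fin 2 → ℂ := star (measKet l α k)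

/-! ### Open graphs, target linear maps, Pauli flow -/

/-- A labelled open graph on the vertex set `N`. -/
structure LabelledOpenGraph (N : Type*) where
  graph : SimpleGraph N
  I : Finset N
  O : Finset N
  label : {v // v ∉ O} → MeasLabel
  angle : {v // v ∉ O} → ℝ

section OpenGraph

variable {N : Type*} [Fintype N]

open Classical in
/-- The odd neighbourhood of `K`. -/
def oddNbhd (G : SimpleGraph N) (K : Finset N) : Finset N :=
  Finset.univ.filter fun u => Odd (Finset.univ.filter fun w => G.Adj u w ∧ w ∈ K).card

open Classical in
/-- The target linear map `(∏_{i ∉ O} ⟨+_{λ(i),α(i)}|_i) E_G N_{Iᶜ}` from the input qubits to the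
output qubits, written out in the computational bases: `N_{Iᶜ}` adds the amplitude `1/√2` for each
non-input, `E_G` a sign for each edge with both ends equal to `1`, and the effects are contracted
with the non-outputs. -/
def LabelledOpenGraph.targetMap (M : LabelledOpenGraph N) :
    Matrix ({v // v ∈ M.O} → Fin 2) ({v // v ∈ M.I} → Fin 2) ℂ :=
  fun y x => ∑ z : N → Fin 2,
    if (∀ v : {v // v ∈ M.O}, z v.1 = y v) ∧ (∀ v : {v // v ∈ M.I}, z v.1 = x v) then
      (∏ i : {v // v ∉ M.O}, measBra (M.label i) (M.angle i) 0 (z i.1)) *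
        (∏ e ∈ M.graph.edgeFinset, if ∀ u ∈ e, z u = 1 then (-1 : ℂ) else 1) *
        rsqrt2 ^ (Finset.univ.filter fun v => v ∉ M.I).card
    else 0

/-- `(p, <)` is a Pauli flow. A vertex without label (an output) counts as a vertex whose label is
none of `X`, `Y`, `Z`. In `flow_Y`, a vertex `w` is exempt exactly if it is strictly after `v`
(for a total order, this is the condition `w ≤ v`). -/
structure IsPauliFlow (M : LabelledOpenGraph N) (p : {v // v ∉ M.O} → Finset N)
    (lt : N → N → Prop) : Prop where
  strictOrder : IsStrictOrder N lt
  range : ∀ v, ∀ w ∈ p v, w ∉ M.I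
  flow_X : ∀ v, ∀ w ∈ p v, w ≠ v.1 →
    (∀ h : w ∉ M.O, M.label ⟨w, h⟩ ≠ .X ∧ M.label ⟨w, h⟩ ≠ .Y) → lt v.1 w
  flow_Z : ∀ v, ∀ w ∈ oddNbhd M.graph (p v), w ≠ v.1 →
    (∀ h : w ∉ M.O, M.label ⟨w, h⟩ ≠ .Y ∧ M.label ⟨w, h⟩ ≠ .Z) → lt v.1 w
  flow_Y : ∀ v w : {v // v ∉ M.O}, w ≠ v → ¬ lt v.1 w.1 → M.label w = .Y →
    (w.1 ∈ p v ↔ w.1 ∈ oddNbhd M.graph (p v))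
  label_XY : ∀ v, M.label v = .XY → v.1 ∉ p v ∧ v.1 ∈ oddNbhd M.graph (p v)
  label_XZ : ∀ v, M.label v = .XZ → v.1 ∈ p v ∧ v.1 ∈ oddNbhd M.graph (p v)
  label_YZ : ∀ v, M.label v = .YZ → v.1 ∈ p v ∧ v.1 ∉ oddNbhd M.graph (p v)
  label_X : ∀ v, M.label v = .X → v.1 ∈ oddNbhd M.graph (p v)
  label_Z : ∀ v, M.label v = .Z → v.1 ∈ p v
  label_Y : ∀ v, M.label v = .Y →
    (v.1 ∉ p v ∧ v.1 ∈ oddNbhd M.graph (p v)) ∨ (v.1 ∈ p v ∧ v.1 ∉ oddNbhd M.graph (p v))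

end OpenGraph

/-! ### XY-fusion networks -/

/-- An XY-fusion network with resource graph on `V`. The multiset of fusions is indexed by `F`;
the fusion `f` acts on the two distinct non-output qubits `fst f` and `snd f`. -/
structure XYFusionNetwork (V F : Type*) where
  graph : SimpleGraph V
  I : Finset V
  O : Finset V
  fst : F → V
  snd : F → V
  fst_notMem : ∀ f, fst f ∉ O
  snd_notMem : ∀ f, snd f ∉ O
  fst_ne_snd : ∀ f, fst f ≠ snd f
  label : {v // v ∉ O} → MeasLabel
  fusionLabel : F → FusionLabel
  angle : {v // v ∉ O} → ℝ

namespace XYFusionNetwork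

variable {V F : Type*} (N : XYFusionNetwork V F)

/-- The resource graph together with one new vertex `Sum.inr f` for each fusion `f`, joined to the
two qubits on which `f` acts. -/
def targetGraph : SimpleGraph (V ⊕ F) where
  Adj a b :=
    match a, b with
    | .inl v, .inl w => N.graph.Adj v w
    | .inl v, .inr f => v = N.fst f ∨ v = N.snd f
    | .inr f, .inl v => v = N.fst f ∨ v = N.snd f
    | .inr _, .inr _ => False
  symm := by
    constructor
    rintro (v | f) (w | g) h
    · exact N.graph.adj_symm h
    · exact h
    · exact h
    · exact h
  loopless := by
    constructor
    rintro (v | f) h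
    · exact N.graph.loopless.irrefl v h
    · exact h

/-- The target open graph. -/
def targetOpenGraph : LabelledOpenGraph (V ⊕ F) where
  graph := N.targetGraph
  I := N.I.disjSum ∅
  O := N.O.disjSum ∅
  label
    | ⟨.inl v, h⟩ => N.label ⟨v, by simpa using h⟩
    | ⟨.inr f, _⟩ => (N.fusionLabel f).toMeas
  angle
    | ⟨.inl v, h⟩ => N.angle ⟨v, by simpa using h⟩
    | ⟨.inr _, _⟩ => 0

/-- Non-outputs of the target open graph: the non-outputs of the resource graph ... -/
def vertexNode (v : {v // v ∉ N.O}) : {n // n ∉ N.targetOpenGraph.O} :=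
  ⟨.inl v.1, by simpa [targetOpenGraph] using v.2⟩

/-- ... and the fusion nodes. -/
def fusionNode (f : F) : {n // n ∉ N.targetOpenGraph.O} :=
  ⟨.inr f, by simp [targetOpenGraph]⟩

/-- Identifies computational basis states of the qubits in `S` with those of the same
qubits seen as vertices of the target open graph. -/
def liftBasis (S : Finset V) (x : {v // v ∈ S} → Fin 2) :
    {n : V ⊕ F // n ∈ S.disjSum (∅ : Finset F)} → Fin 2
  | ⟨.inl v, h⟩ => x ⟨v, by simpa using h⟩
  | ⟨.inr _, h⟩ => absurd h (by simp)

/-- The target linear map of the network: that of its target open graph. -/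
def targetMap [Fintype V] [Fintype F] :
    Matrix ({v // v ∈ N.O} → Fin 2) ({v // v ∈ N.I} → Fin 2) ℂ :=
  fun y x => N.targetOpenGraph.targetMap (liftBasis N.O y) (liftBasis N.I x)

/-- An XY-flow: a Pauli flow on the target open graph for which no corrections are needed on the
fusion nodes. A Pauli operator on a node measured in the basis `X` or `Y` needs no correction
exactly if it is trivial or that same Pauli operator. -/
structure IsXYFlow [Fintype V] [Fintype F]
    (p : {n // n ∉ N.targetOpenGraph.O} → Finset (V ⊕ F))
    (lt : V ⊕ F → V ⊕ F → Prop) : Prop where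
  pauliFlow : IsPauliFlow N.targetOpenGraph p lt
  fusion_X : ∀ f, N.fusionLabel f = .X → ∀ v, v ≠ N.fusionNode f →
    (.inr f) ∉ oddNbhd N.targetGraph (p v)
  fusion_Y : ∀ f, N.fusionLabel f = .Y → ∀ v, v ≠ N.fusionNode f →
    ((.inr f) ∈ p v ↔ (.inr f) ∈ oddNbhd N.targetGraph (p v))

end XYFusionNetwork

/-! ### XY-fusion patterns -/

/-- Commands on the register `V`. The outcome of the measurement of `i` is the variable
`Sum.inl i`; the outcome of the fusion `f` is the variable `Sum.inr f`. Corrections depend on the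
sum modulo 2 of a set `t` of outcome variables. -/
inductive Command (V F : Type*)
  | prep (i : V)
  | entangle (i j : V)
  | fuse (f : F) (i j : V) (l : FusionLabel)
  | measure (i : V) (l : MeasLabel) (α : ℝ)
  | corrX (i : V) (t : Finset (V ⊕ F))
  | corrZ (i : V) (t : Finset (V ⊕ F))

/-- A pattern; the commands are listed in the order of their execution. -/
structure Pattern (V F : Type*) where
  I : Finset V
  O : Finset V
  commands : List (Command V F)

section Semantics

variable {V F : Type*} [Fintype V] [DecidableEq V]

/-- The operator `A` on qubit `i`, identity on the others. -/
def onQubit (i : V) (A : Matrix (Fin 2) (Fin 2) ℂ) : Matrix (V → Fin 2) (V → Fin 2) ℂ :=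
  fun z w => if ∀ j, j ≠ i → z j = w j then A (z i) (w i) else 0

def pauliX : Matrix (Fin 2) (Fin 2) ℂ := !![0, 1; 1, 0]
def pauliZ : Matrix (Fin 2) (Fin 2) ℂ := !![1, 0; 0, -1]

/-- The controlled-`Z` gate. -/
def cz (i j : V) : Matrix (V → Fin 2) (V → Fin 2) ℂ :=
  Matrix.diagonal fun z => if z i = 1 ∧ z j = 1 then -1 else 1

/-- Kraus operator of a successful fusion of `i` and `j` with outcome `k`:
`(1 + (-1)^k Z_i Z_j) / 2` for an X-fusion (the projector on even or odd parity) and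
`(1 - (-1)^k i Z_i Z_j) / 2` for a Y-fusion. These are the operators
`⟨±_λ|_f CZ_{fi} CZ_{fj} |+⟩_f`, normalised to sum to a channel over `k`. -/
def fusionKraus (l : FusionLabel) (i j : V) (k : ZMod 2) : Matrix (V → Fin 2) (V → Fin 2) ℂ :=
  let zz : Matrix (V → Fin 2) (V → Fin 2) ℂ := onQubit i pauliZ * onQubit j pauliZ
  match l with
  | .X => (1 / 2 : ℂ) • (1 + sgn k • zz)
  | .Y => (1 / 2 : ℂ) • (1 - (sgn k * Complex.I) • zz)

/-- The operator of a command in the success branch with outcomes `k`. All operators act on the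
whole register; a qubit that is not yet prepared, or already measured, is kept in the
state `|0⟩`. So a preparation is `|+⟩⟨0|` and a destructive measurement is `|0⟩⟨±_{λ,α}|`. -/
def Command.op (k : V ⊕ F → ZMod 2) : Command V F → Matrix (V → Fin 2) (V → Fin 2) ℂ
  | .prep i => onQubit i (Matrix.vecMulVec (ketX 0) ket0)
  | .entangle i j => cz i j
  | .fuse f i j l => fusionKraus l i j (k (.inr f))
  | .measure i l α => onQubit i (Matrix.vecMulVec ket0 (measBra l α (k (.inl i))))
  | .corrX i t => if ∑ s ∈ t, k s = 1 then onQubit i pauliX else 1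
  | .corrZ i t => if ∑ s ∈ t, k s = 1 then onQubit i pauliZ else 1

/-- The isometry that puts the qubits of `S` in the register and all others in the state `|0⟩`. -/
def embed (S : Finset V) : Matrix (V → Fin 2) ({v // v ∈ S} → Fin 2) ℂ :=
  fun z x => if z = (fun v => if h : v ∈ S then x ⟨v, h⟩ else 0) then 1 else 0

namespace Pattern

/-- The success branch with outcomes `k`, a linear map from the input qubits to the register
(in which qubits that are not alive are in the state `|0⟩`). -/
def branch (P : Pattern V F) (k : V ⊕ F → ZMod 2) :
    Matrix (V → Fin 2) ({v // v ∈ P.I} → Fin 2) ℂ :=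
  P.commands.foldl (fun A c => c.op k * A) (embed P.I)

/-- The success branches are proportional to each other. -/
def IsDeterministic (P : Pattern V F) : Prop :=
  ∀ k k' : V ⊕ F → ZMod 2, ∃ c : ℂ, c ≠ 0 ∧ P.branch k = c • P.branch k'

/-- The success branches are equal up to a global phase. -/
def IsStronglyDeterministic (P : Pattern V F) : Prop :=
  ∀ k k' : V ⊕ F → ZMod 2, ∃ c : ℂ, ‖c‖ = 1 ∧ P.branch k = c • P.branch k'

end Pattern

/-- Replaces the measurement angle of each qubit `i` by `θ i`. -/
def Command.withAngles (θ : V → ℝ) : Command V F → Command V F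
  | .measure i l _ => .measure i l (θ i)
  | c => c

/-- Deterministic on success for all choices of the measurement angles. -/
def Pattern.IsUniformlyDeterministic (P : Pattern V F) : Prop :=
  ∀ θ : V → ℝ, Pattern.IsDeterministic
    { P with commands := P.commands.map (Command.withAngles θ) }

variable [DecidableEq F]

/-- The outcome variables produced by a list of commands. -/
def outcomes : List (Command V F) → Finset (V ⊕ F)
  | [] => ∅
  | .fuse f _ _ _ :: cs => insert (.inr f) (outcomes cs)
  | .measure i _ _ :: cs => insert (.inl i) (outcomes cs)
  | _ :: cs => outcomes cs

/-- Keeps a correction if it depends on the outcome `s` (dropping its dependence on outcomes that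
are not in `known`), and discards every other command. -/
def Command.correctionFor (s : V ⊕ F) (known : Finset (V ⊕ F)) :
    Command V F → Option (Command V F)
  | .corrX j t => if s ∈ t then some (.corrX j (t ∩ known)) else none
  | .corrZ j t => if s ∈ t then some (.corrZ j (t ∩ known)) else none
  | _ => none

/-- For every single-qubit measurement command, the pattern truncated after this
command and completed by the later corrections that depend on its outcome is deterministic on
success. -/
def Pattern.IsStepwiseDeterministic (P : Pattern V F) : Prop :=
  ∀ (pre post : List (Command V F)) (i : V) (l : MeasLabel) (α : ℝ),
    P.commands = pre ++ .measure i l α :: post →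
    Pattern.IsDeterministic
      { P with
        commands := pre ++ .measure i l α ::
          post.filterMap (Command.correctionFor (.inl i) (insert (.inl i) (outcomes pre))) }

/-- Runnability of a list of commands, when the qubits in `live` are prepared and not measured, the
qubits in `gone` are measured and the outcomes in `known` are known. At the end, the qubits that
are left must be the outputs. -/
def RunnableFrom (I O : Finset V) :
    Finset V → Finset V → Finset (V ⊕ F) → List (Command V F) → Prop
  | live, _, _, [] => live = O
  | live, gone, known, .prep i :: cs =>
      i ∉ I ∧ i ∉ live ∧ i ∉ gone ∧ RunnableFrom I O (insert i live) gone known cs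
  | live, gone, known, .entangle i j :: cs =>
      i ≠ j ∧ i ∈ live ∧ j ∈ live ∧ RunnableFrom I O live gone known cs
  | live, gone, known, .fuse f i j _ :: cs =>
      i ≠ j ∧ i ∈ live ∧ j ∈ live ∧ .inr f ∉ known ∧
        RunnableFrom I O live gone (insert (.inr f) known) cs
  | live, gone, known, .measure i _ _ :: cs =>
      i ∉ O ∧ i ∈ live ∧
        RunnableFrom I O (live.erase i) (insert i gone) (insert (.inl i) known) cs
  | live, gone, known, .corrX i t :: cs =>
      i ∈ live ∧ t ⊆ known ∧ RunnableFrom I O live gone known cs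
  | live, gone, known, .corrZ i t :: cs =>
      i ∈ live ∧ t ⊆ known ∧ RunnableFrom I O live gone known cs

/-- No command acts on a qubit that is already measured or not yet prepared, no correction depends
on an outcome that is not yet known, and exactly the non-outputs are measured. -/
def Pattern.IsRunnable (P : Pattern V F) : Prop :=
  RunnableFrom P.I P.O P.I ∅ ∅ P.commands

/-- Every success branch is a non-zero multiple of the linear map `T` from inputs to outputs. -/
def Pattern.ImplementsOnSuccess (P : Pattern V F)
    (T : Matrix ({v // v ∈ P.O} → Fin 2) ({v // v ∈ P.I} → Fin 2) ℂ) : Prop :=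
  ∀ k : V ⊕ F → ZMod 2, ∃ c : ℂ, c ≠ 0 ∧ P.branch k = c • (embed P.O * T)

/-- The pattern is runnable, uniformly, strongly and stepwise deterministic on success, and
implements `T` when all fusions are successful. -/
structure Pattern.DeterministicallyImplements (P : Pattern V F)
    (T : Matrix ({v // v ∈ P.O} → Fin 2) ({v // v ∈ P.I} → Fin 2) ℂ) : Prop where
  runnable : P.IsRunnable
  uniform : P.IsUniformlyDeterministic
  strong : P.IsStronglyDeterministic
  stepwise : P.IsStepwiseDeterministic
  implements : P.ImplementsOnSuccess T

end Semantics

/-! ### The pattern of an XY-flow -/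

namespace XYFusionNetwork

variable {V F : Type*} [Fintype V] [Fintype F] [DecidableEq V]
  (N : XYFusionNetwork V F) (p : {n // n ∉ N.targetOpenGraph.O} → Finset (V ⊕ F))

open Classical in
/-- The preparations `N_{Iᶜ}` followed by the entangling commands `E_G` of all edges. -/
def preparationCommands : List (Command V F) :=
  ((N.I)ᶜ.toList.map fun i => .prep i) ++
    N.graph.edgeFinset.toList.map fun e => .entangle e.out.1 e.out.2

open Classical in
/-- The corrections `X^{k_u}_{p(u) ∩ S} Z^{k_u}_{Odd(p(u)) ∩ S}` for the node `u`, where `S` is a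
set of qubits of the register. -/
def corrections (u : {n // n ∉ N.targetOpenGraph.O}) (S : Finset V) : List (Command V F) :=
  ((S.filter fun j => .inl j ∈ oddNbhd N.targetGraph (p u)).toList.map
    fun j => .corrZ j {u.1}) ++
  ((S.filter fun j => .inl j ∈ p u).toList.map fun j => .corrX j {u.1})

/-- All fusions in the order of the list, then their corrections. All qubits of the
register come after the fusions. -/
def fusionCommands (fs : List F) : List (Command V F) :=
  (fs.map fun f => .fuse f (N.fst f) (N.snd f) (N.fusionLabel f)) ++
    fs.flatMap fun f => N.corrections p (N.fusionNode f) Finset.univ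

/-- The fusions in the order of the list, each one immediately followed by its corrections. -/
def interleavedFusionCommands (fs : List F) : List (Command V F) :=
  fs.flatMap fun f =>
    .fuse f (N.fst f) (N.snd f) (N.fusionLabel f) ::
      N.corrections p (N.fusionNode f) Finset.univ

/-- The measurements in the order of the list, each followed by its corrections on the
qubits that come later: those still to be measured, and the outputs. -/
def measurementCommands : List {v // v ∉ N.O} → List (Command V F)
  | [] => []
  | i :: rest =>
      .measure i.1 (N.label i) (N.angle i) ::
        (N.corrections p (N.vertexNode i) ((rest.map Subtype.val).toFinset ∪ N.O) ++
          measurementCommands rest)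

/-- The XY-fusion pattern of `p`, with fusions in the order `fs` (all fusions before the first
correction) and measurements in the order `vs`. -/
def flowPattern (fs : List F) (vs : List {v // v ∉ N.O}) : Pattern V F where
  I := N.I
  O := N.O
  commands := N.preparationCommands ++ N.fusionCommands p fs ++ N.measurementCommands p vs

/-- The same pattern with the corrections of each fusion moved directly behind that fusion. -/
def interleavedFlowPattern (fs : List F) (vs : List {v // v ∉ N.O}) : Pattern V F where
  I := N.I
  O := N.O
  commands :=
    N.preparationCommands ++ N.interleavedFusionCommands p fs ++ N.measurementCommands p vs

end XYFusionNetwork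

end XYFusion

end

/-!
The pattern is deterministic because every correction can be completed to a stabilizer of a graph
state, and the part of the stabilizer that is missing from the pattern acts on nodes that are
projected anyway.

A successful fusion acts on its two qubits like a new node `f` in the state `|+⟩` which is joined to
them by controlled-`Z` gates and then projected onto `⟨±_λ|`
(`XYFusion.fusionKraus_mul_apply`). Hence every state reached after the fusions is a
`partialState`: the graph state `Γ` of the target open graph, with all nodes outside the set `L` of
live qubits projected onto the effects of their outcomes
(`XYFusion.XYFusionNetwork.run_fuse_eq_partialState`). Measuring a qubit removes it from
`L`, and Pauli operators on live qubits may be applied before the projections.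

Shifting a basis state by `K` changes the sign of its amplitude in a graph state by the character of
`Odd(K)`, so `X_K Z_{Odd(K)}` fixes `Γ` up to a sign when `K` contains no input
(`XYFusion.exists_pauliAct_graphState`). The corrections of a node `u` with outcome `1` apply this
operator, for `K = p(u)`, to the live qubits only. Multiplying with the full stabilizer cancels them
and leaves a Pauli operator `X^a Z^b` on the projected nodes. The invariant
`XYFusion.XYFusionNetwork.Reached` says that at each projected node the exponents `(a, b)`
compensate the outcome `κ` of the node if its corrections have been applied, and leave its effect
invariant otherwise; here "compensate" means that `X^a Z^b` turns the effect of outcome `κ` into that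
of outcome `0`, up to a phase. For each label this is a linear condition on `(κ, a, b)` over `𝔽₂`
(`XYFusion.Compensates`), so the contributions of the nodes can be added up one at a time: the
contribution of `u` at `u` itself is governed by the label conditions of the Pauli flow, those at
previously measured qubits by its order conditions, and those at fusion nodes by the additional
conditions of an XY-flow. When all corrections are done, the state is a phase times the one for the
outcomes `0`, which is the target linear map if only the outputs are live.

The same argument applies to patterns which stop after some measurement, with the qubits still to be
measured kept alive, and to arbitrary angles, which yields stepwise and uniform determinism. Finally,
a fusion `g` is diagonal and depends only on the parity of its two qubits, which the corrections of
`f` change exactly if `g ∈ Odd(p(f))`. For an X-fusion this is excluded, and for a Y-fusion it is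
equivalent to `g ∈ p(f)`; so under the additional hypothesis corrections commute with later fusions
(`XYFusion.XYFusionNetwork.run_fuse_corrections`).
-/

noncomputable section

namespace XYFusion

open Matrix

/-! ### Signs and Pauli operators on a register -/

/-- The matrix element `(-1)^{xy}` of the controlled-`Z` gate. -/
def czSign (x y : Fin 2) : ℂ := if x = 1 ∧ y = 1 then -1 else 1

theorem czSign_add_left (x x' y : Fin 2) : czSign (x + x') y = czSign x y * czSign x' y := by
  fin_cases x <;> fin_cases x' <;> fin_cases y <;> simp [czSign]

theorem czSign_comm (x y : Fin 2) : czSign x y = czSign y x := by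
  simp [czSign, and_comm]

theorem czSign_add_right (x y y' : Fin 2) : czSign x (y + y') = czSign x y * czSign x y' := by
  rw [czSign_comm, czSign_add_left, czSign_comm y, czSign_comm y']

@[simp] theorem czSign_zero_left (y : Fin 2) : czSign 0 y = 1 := by simp [czSign]

@[simp] theorem czSign_zero_right (x : Fin 2) : czSign x 0 = 1 := by simp [czSign]

theorem norm_czSign (x y : Fin 2) : ‖czSign x y‖ = 1 := by
  unfold czSign; split_ifs <;> simp

theorem czSign_mul_self (x y : Fin 2) : czSign x y * czSign x y = 1 := by
  unfold czSign; split_ifs <;> simp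

theorem fin_two_add_self (x : Fin 2) : x + x = 0 := by fin_cases x <;> rfl

section Register

variable {W X : Type*}

theorem register_add_self (z : W → Fin 2) : z + z = 0 := funext fun _ => fin_two_add_self _

theorem register_add_add_cancel (z a : W → Fin 2) : z + a + a = z := by
  rw [add_assoc, register_add_self, add_zero]

open Classical in
/-- The characteristic vector of a set of vertices. -/
def bits (K : Finset W) : W → Fin 2 := fun w => if w ∈ K then 1 else 0

theorem bits_of_mem {K : Finset W} {w : W} (h : w ∈ K) : bits K w = 1 := if_pos h

theorem bits_of_notMem {K : Finset W} {w : W} (h : w ∉ K) : bits K w = 0 := if_neg h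

theorem ite_forall_mem_edge (z : W → Fin 2) (u v : W) [Decidable (∀ w ∈ s(u, v), z w = 1)] :
    (if ∀ w ∈ s(u, v), z w = 1 then (-1 : ℂ) else 1) = czSign (z u) (z v) := by
  simp [czSign]

variable [Fintype W]

/-- The sign `(-1)^{b·z}`, that is, the eigenvalue of `Z^b` on the basis state `z`. -/
def pairing (b z : W → Fin 2) : ℂ := ∏ w, czSign (b w) (z w)

theorem pairing_add_left (b b' z : W → Fin 2) :
    pairing (b + b') z = pairing b z * pairing b' z := by
  simp [pairing, czSign_add_left, Finset.prod_mul_distrib]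

theorem pairing_add_right (b z z' : W → Fin 2) :
    pairing b (z + z') = pairing b z * pairing b z' := by
  simp [pairing, czSign_add_right, Finset.prod_mul_distrib]

@[simp] theorem pairing_zero_left (z : W → Fin 2) : pairing 0 z = 1 := by simp [pairing]

@[simp] theorem pairing_zero_right (z : W → Fin 2) : pairing z 0 = 1 := by simp [pairing]

theorem norm_pairing (b z : W → Fin 2) : ‖pairing b z‖ = 1 := by
  simp [pairing, norm_prod, norm_czSign]

theorem pairing_mul_self (b z : W → Fin 2) : pairing b z * pairing b z = 1 := by
  simp [pairing, ← Finset.prod_mul_distrib, czSign_mul_self]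

/-- The Pauli operator `X^a Z^b` applied to the columns of `A`. -/
def pauliAct (a b : W → Fin 2) (A : Matrix (W → Fin 2) X ℂ) : Matrix (W → Fin 2) X ℂ :=
  fun z x => pairing b (z + a) * A (z + a) x

@[simp] theorem pauliAct_zero (A : Matrix (W → Fin 2) X ℂ) : pauliAct 0 0 A = A := by
  ext z x; simp [pauliAct]

theorem pauliAct_smul (a b : W → Fin 2) (c : ℂ) (A : Matrix (W → Fin 2) X ℂ) :
    pauliAct a b (c • A) = c • pauliAct a b A := by
  ext z x; simp [pauliAct]; ring

theorem pauliAct_pauliAct (a a' b b' : W → Fin 2) (A : Matrix (W → Fin 2) X ℂ) :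
    pauliAct a' b' (pauliAct a b A) = pairing b' a • pauliAct (a + a') (b + b') A := by
  ext z x
  have h : z + (a + a') = z + a' + a := by rw [add_comm a, add_assoc]
  simp only [pauliAct, Matrix.smul_apply, smul_eq_mul, pairing_add_left, h,
    pairing_add_right b' (z + a') a]
  linear_combination (- pairing b' (z + a') * pairing b (z + a' + a) * A (z + a' + a) x) *
    pairing_mul_self b' a

/-! ### Graph states and their stabilizers -/

open Classical in
/-- The amplitude of the basis state `z` in the product of the controlled-`Z` gates along all
edges of `G`. -/
def edgeSign (G : SimpleGraph W) (z : W → Fin 2) : ℂ :=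
  ∏ e ∈ G.edgeFinset, if ∀ u ∈ e, z u = 1 then (-1 : ℂ) else 1

theorem norm_edgeSign (G : SimpleGraph W) (z : W → Fin 2) : ‖edgeSign G z‖ = 1 := by
  rw [edgeSign, norm_prod]
  exact Finset.prod_eq_one fun e _ => by split_ifs <;> simp

open Classical in
/-- A product over ordered adjacent pairs is a product over edges. -/
theorem prod_adj_pairs (G : SimpleGraph W) (g : W → W → ℂ) (h : Sym2 W → ℂ)
    (hg : ∀ u v, h s(u, v) = g u v * g v u) :
    ∏ u, ∏ v, (if G.Adj u v then g u v else 1) = ∏ e ∈ G.edgeFinset, h e := by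
  rw [← Finset.prod_product' Finset.univ Finset.univ
    (fun u v => if G.Adj u v then g u v else 1), ← Finset.prod_filter (s := Finset.univ ×ˢ _)
    (fun x : W × W => G.Adj x.1 x.2) (fun x => g x.1 x.2),
    ← Finset.prod_fiberwise_of_maps_to (t := G.edgeFinset) (g := fun x : W × W => s(x.1, x.2))
    (by simp)]
  refine Finset.prod_congr rfl fun e he => ?_
  induction e using Sym2.ind with | _ u v =>
  have huv : G.Adj u v := by simpa using he
  have : ((Finset.univ ×ˢ Finset.univ).filter fun x : W × W => G.Adj x.1 x.2).filter
      (fun x => s(x.1, x.2) = s(u, v)) = {(u, v), (v, u)} := by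
    ext ⟨x, y⟩
    simp only [Finset.mem_filter, Finset.mem_product, Finset.mem_univ, true_and, Sym2.eq_iff,
      Finset.mem_insert, Finset.mem_singleton, Prod.mk.injEq, and_true]
    constructor
    · exact fun h => h.2
    · rintro (⟨rfl, rfl⟩ | ⟨rfl, rfl⟩)
      · exact ⟨huv, .inl ⟨rfl, rfl⟩⟩
      · exact ⟨huv.symm, .inr ⟨rfl, rfl⟩⟩
  rw [this, Finset.prod_pair (by simp [huv.ne]), hg]

theorem czSign_pow (x : Fin 2) (n : ℕ) [Decidable (Odd n)] :
    czSign x 1 ^ n = czSign (if Odd n then 1 else 0) x := by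
  by_cases hx : x = 1
  · subst hx
    split_ifs with h
    · simp [czSign, h.neg_one_pow]
    · simp [czSign, (Nat.not_odd_iff_even.1 h).neg_one_pow]
  · simp [czSign, hx]

/-- Shifting a basis state by `K` changes the amplitude of the graph state by the eigenvalue of
`Z_{Odd(K)}`, up to a global sign. -/
theorem edgeSign_add_bits (G : SimpleGraph W) (K : Finset W) (z : W → Fin 2) :
    edgeSign G (z + bits K) =
      edgeSign G (bits K) * (edgeSign G z * pairing (bits (oddNbhd G K)) z) := by
  classical
  have h1 : pairing (bits (oddNbhd G K)) z =
      ∏ u, ∏ v, (if G.Adj u v then czSign (z u) (bits K v) else 1) := by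
    refine Finset.prod_congr rfl fun u _ => ?_
    have : ∀ v, (if G.Adj u v then czSign (z u) (bits K v) else 1) =
        if G.Adj u v ∧ v ∈ K then czSign (z u) 1 else 1 := by
      intro v
      by_cases h : G.Adj u v <;> by_cases h' : v ∈ K <;> simp [bits, h, h']
    rw [Finset.prod_congr rfl fun v _ => this v, ← Finset.prod_filter, Finset.prod_const,
      czSign_pow]
    simp [bits, oddNbhd]
  rw [h1, prod_adj_pairs G _ (Sym2.lift ⟨fun u v =>
    czSign (z u) (bits K v) * czSign (z v) (bits K u), fun u v => mul_comm _ _⟩) (fun u v => rfl)]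
  simp only [edgeSign, ← Finset.prod_mul_distrib]
  refine Finset.prod_congr rfl fun e _ => ?_
  induction e using Sym2.ind with | _ u v =>
  simp only [ite_forall_mem_edge, Sym2.lift_mk, Pi.add_apply, czSign_add_left, czSign_add_right,
    czSign_comm (bits K u) (z v)]
  ring

/-- The columns of `E_G N_{Iᶜ}`: the graph state of `G` with open inputs `I`. -/
def graphState (G : SimpleGraph W) (I : Finset W) (κ : ℂ) :
    Matrix (W → Fin 2) ({v // v ∈ I} → Fin 2) ℂ :=
  open Classical in
  fun z x => if ∀ v : {v // v ∈ I}, z v.1 = x v then κ * edgeSign G z else 0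

/-- For `K` disjoint from the inputs, `X_K Z_{Odd(K)}` stabilizes the graph state up to a sign. -/
theorem exists_pauliAct_graphState (G : SimpleGraph W) (I : Finset W) (κ : ℂ) (K : Finset W)
    (hK : ∀ w ∈ K, w ∉ I) :
    ∃ c : ℂ, ‖c‖ = 1 ∧
      graphState G I κ = c • pauliAct (bits K) (bits (oddNbhd G K)) (graphState G I κ) := by
  have hn : ‖edgeSign G (bits K)‖ = 1 := norm_edgeSign G _
  have hn' : ‖pairing (bits (oddNbhd G K)) (bits K)‖ = 1 := norm_pairing _ _
  have h0 : edgeSign G (bits K) ≠ 0 := norm_ne_zero_iff.1 (by simp [hn])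
  have h0' : pairing (bits (oddNbhd G K)) (bits K) ≠ 0 := norm_ne_zero_iff.1 (by simp [hn'])
  refine ⟨(edgeSign G (bits K))⁻¹ * (pairing (bits (oddNbhd G K)) (bits K))⁻¹,
    by simp [hn, hn'], ?_⟩
  ext z x
  have hI : (∀ v : {v // v ∈ I}, (z + bits K) v.1 = x v) ↔ ∀ v : {v // v ∈ I}, z v.1 = x v := by
    refine forall_congr' fun v => ?_
    rw [Pi.add_apply, bits_of_notMem fun h => hK _ h v.2, add_zero]
  simp only [graphState, pauliAct, Matrix.smul_apply, smul_eq_mul, hI]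
  split_ifs
  · rw [edgeSign_add_bits, pairing_add_right]
    field_simp
    linear_combination (-κ * edgeSign G z) * pairing_mul_self (bits (oddNbhd G K)) z
  · simp

end Register

/-! ### The action of the commands -/

section Commands

theorem sum_single_toList {V : Type*} [DecidableEq V] (S : Finset V) :
    (S.toList.map fun j => (Pi.single j 1 : V → Fin 2)).sum = bits S := by
  rw [Finset.sum_map_toList]
  ext v
  rw [Finset.sum_apply]
  by_cases hv : v ∈ S <;> simp [Pi.single_apply, bits, hv]

theorem update_eq_add_single {V : Type*} [DecidableEq V] (z : V → Fin 2) (i : V) (b : Fin 2) :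
    Function.update z i (z i + b) = z + Pi.single i b := by
  ext j
  by_cases hj : j = i
  · subst hj; simp
  · simp [hj]

variable {V F X : Type*} [Fintype V] [DecidableEq V]

/-- The effect of a list of commands on a register state in the success branch `k`. -/
def run (k : V ⊕ F → ZMod 2) (cs : List (Command V F)) (A : Matrix (V → Fin 2) X ℂ) :
    Matrix (V → Fin 2) X ℂ :=
  cs.foldl (fun A c => c.op k * A) A

@[simp] theorem run_nil (k : V ⊕ F → ZMod 2) (A : Matrix (V → Fin 2) X ℂ) : run k [] A = A := rfl

@[simp] theorem run_cons (k : V ⊕ F → ZMod 2) (c : Command V F) (cs : List (Command V F))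
    (A : Matrix (V → Fin 2) X ℂ) : run k (c :: cs) A = run k cs (c.op k * A) := rfl

theorem run_append (k : V ⊕ F → ZMod 2) (cs ds : List (Command V F))
    (A : Matrix (V → Fin 2) X ℂ) : run k (cs ++ ds) A = run k ds (run k cs A) :=
  List.foldl_append

theorem onQubit_mul_apply (i : V) (M : Matrix (Fin 2) (Fin 2) ℂ) (A : Matrix (V → Fin 2) X ℂ)
    (z : V → Fin 2) (x : X) :
    (onQubit i M * A) z x = ∑ b, M (z i) b * A (Function.update z i b) x := by
  rw [mul_apply]
  symm
  refine Finset.sum_of_injOn (fun b => Function.update z i b) ?_ (by simp) ?_ ?_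
  · intro b _ b' _ h
    simpa using congrFun h i
  · intro w _ hw
    rw [onQubit, if_neg, zero_mul]
    intro h
    refine hw ⟨w i, by simp, ?_⟩
    ext j
    by_cases hj : j = i
    · subst hj; simp
    · simp [hj, h j hj]
  · intro b _
    rw [onQubit, if_pos]
    · simp
    · intro j hj; simp [hj]

theorem pairing_single (i : V) (z : V → Fin 2) : pairing (Pi.single i 1) z = czSign 1 (z i) := by
  rw [pairing, Finset.prod_eq_single i]
  · simp
  · intro j _ hj; simp [hj]
  · simp

theorem onQubit_pauliX_mul (i : V) (A : Matrix (V → Fin 2) X ℂ) :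
    onQubit i pauliX * A = pauliAct (Pi.single i 1) 0 A := by
  ext z x
  rw [onQubit_mul_apply, pauliAct, ← update_eq_add_single]
  generalize hb : z i = b
  fin_cases b <;> simp [pauliX]

theorem onQubit_pauliZ_mul (i : V) (A : Matrix (V → Fin 2) X ℂ) :
    onQubit i pauliZ * A = pauliAct 0 (Pi.single i 1) A := by
  ext z x
  rw [onQubit_mul_apply, pauliAct, add_zero, pairing_single]
  conv_rhs => rw [← Function.update_eq_self i z]
  generalize hb : z i = b
  fin_cases b <;> simp [pauliZ, czSign]

theorem cz_mul_apply (i j : V) (A : Matrix (V → Fin 2) X ℂ) (z : V → Fin 2) (x : X) :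
    (cz i j * A) z x = czSign (z i) (z j) * A z x := by
  rw [cz, diagonal_mul]; rfl

/-- The diagonal entry of the Kraus operator of a fusion, for basis states `a` and `b` of its
qubits: the scalar `⟨±_λ| CZ_{fi} CZ_{fj} |+⟩` of a fusion node with neighbours in these states. -/
def fusionAmplitude (l : FusionLabel) (k : ZMod 2) (a b : Fin 2) : ℂ :=
  ∑ t, measBra l.toMeas 0 k t * (rsqrt2 * (czSign t a * czSign t b))

theorem rsqrt2_mul_self : rsqrt2 * rsqrt2 = 1 / 2 := by
  rw [rsqrt2, ← mul_inv, ← Complex.ofReal_mul, Real.mul_self_sqrt (by norm_num)]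
  norm_num

theorem star_rsqrt2 : star rsqrt2 = rsqrt2 := by
  simp [rsqrt2]

theorem zmod_two_cases (k : ZMod 2) : k = 0 ∨ k = 1 := by revert k; decide

@[simp] theorem sgn_zero : sgn 0 = 1 := if_pos rfl
@[simp] theorem sgn_one : sgn 1 = -1 := if_neg one_ne_zero

theorem fusionKraus_mul_apply (l : FusionLabel) (i j : V) (k : ZMod 2)
    (A : Matrix (V → Fin 2) X ℂ) (z : V → Fin 2) (x : X) :
    (fusionKraus l i j k * A) z x = fusionAmplitude l k (z i) (z j) * A z x := by
  have hs : star rsqrt2 = rsqrt2 := star_rsqrt2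
  have hs' : (starRingEnd ℂ) rsqrt2 = rsqrt2 := star_rsqrt2
  have hzz : (onQubit i pauliZ * onQubit j pauliZ * A) z x =
      czSign 1 (z i) * (czSign 1 (z j) * A z x) := by
    rw [Matrix.mul_assoc, onQubit_pauliZ_mul, onQubit_pauliZ_mul]
    simp [pauliAct, pairing_single]
  have h2 := rsqrt2_mul_self
  cases l
  · have : (fusionKraus .X i j k * A) z x =
        1 / 2 * (A z x + sgn k * (czSign 1 (z i) * (czSign 1 (z j) * A z x))) := by
      rw [← hzz]
      simp [fusionKraus, Matrix.add_mul, mul_add]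
    rw [this]
    simp only [fusionAmplitude, Fin.sum_univ_two, FusionLabel.toMeas, measBra, measKet, ketX, ket0,
      ket1]
    generalize z i = a
    generalize z j = b
    rcases zmod_two_cases k with rfl | rfl <;> simp [hs']
    · linear_combination (-(A z x) - (czSign 1 a * czSign 1 b * A z x)) * h2
    · linear_combination (-(A z x) + (czSign 1 a * czSign 1 b * A z x)) * h2
  · have : (fusionKraus .Y i j k * A) z x =
        1 / 2 * (A z x - sgn k * Complex.I * (czSign 1 (z i) * (czSign 1 (z j) * A z x))) := by
      rw [← hzz]
      simp [fusionKraus, Matrix.sub_mul, mul_sub]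
    rw [this]
    simp only [fusionAmplitude, Fin.sum_univ_two, FusionLabel.toMeas, measBra, measKet, ketY, ket0,
      ket1]
    generalize z i = a
    generalize z j = b
    rcases zmod_two_cases k with rfl | rfl <;> simp [hs']
    · linear_combination (-(A z x) + Complex.I * (czSign 1 a * czSign 1 b * A z x)) * h2
    · linear_combination (-(A z x) - Complex.I * (czSign 1 a * czSign 1 b * A z x)) * h2

theorem prep_mul_apply (i : V) (A : Matrix (V → Fin 2) X ℂ) (z : V → Fin 2) (x : X) :
    (onQubit i (vecMulVec (ketX 0) ket0) * A) z x = rsqrt2 * A (Function.update z i 0) x := by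
  rw [onQubit_mul_apply]
  generalize z i = b
  fin_cases b <;> simp [vecMulVec_apply, ketX, ket0, ket1]

/-! ### Preparation of the graph state -/

/-- The unnormalised product state in which the input qubits carry the input, the qubits outside
`S` are in the state `|0⟩`, and the remaining ones are in the state `|0⟩ + |1⟩`. -/
def productState (I S : Finset V) (κ : ℂ) : Matrix (V → Fin 2) ({v // v ∈ I} → Fin 2) ℂ :=
  fun z x => if (∀ v : {v // v ∈ I}, z v.1 = x v) ∧ ∀ v, v ∉ S → z v = 0 then κ else 0

theorem run_prep (k : V ⊕ F → ZMod 2) (I : Finset V) (l : List V) (hl : l.Nodup)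
    (hI : ∀ i ∈ l, i ∉ I) (S : Finset V) (hS : ∀ i ∈ l, i ∉ S) (κ : ℂ) :
    run k (l.map Command.prep) (productState I S κ) =
      productState I (S ∪ l.toFinset) (κ * rsqrt2 ^ l.length) := by
  induction l generalizing S κ with
  | nil => simp
  | cons i l ih =>
    rw [List.nodup_cons] at hl
    simp only [List.mem_cons, forall_eq_or_imp] at hI hS
    have h : Command.op k (.prep i : Command V F) * productState I S κ =
        productState I (insert i S) (κ * rsqrt2) := by
      ext z x
      rw [Command.op, prep_mul_apply, productState, mul_ite, mul_zero, mul_comm rsqrt2]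
      refine if_congr (and_congr (forall_congr' fun v => ?_) (forall_congr' fun v => ?_)) rfl rfl
      · rw [Function.update_of_ne]
        rintro h
        exact hI.1 (h ▸ v.2)
      · by_cases hv : v = i
        · subst hv; simp
        · simp [hv]
    rw [List.map_cons, run_cons, h, ih hl.2 hI.2 _ (fun j hj => by
      simp only [Finset.mem_insert, not_or]
      exact ⟨fun h => hl.1 (h ▸ hj), hS.2 j hj⟩)]
    congr 1
    · simp [Finset.insert_union, Finset.union_insert]
    · simp; ring

theorem embed_apply (I : Finset V) (z : V → Fin 2) (x : {v // v ∈ I} → Fin 2) :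
    embed I z x = if (∀ v : {v // v ∈ I}, z v.1 = x v) ∧ ∀ v, v ∉ I → z v = 0 then 1 else 0 := by
  refine if_congr ⟨?_, ?_⟩ rfl rfl
  · rintro rfl
    exact ⟨fun v => by simp, fun v hv => by simp [hv]⟩
  · rintro ⟨h1, h2⟩
    ext v
    by_cases hv : v ∈ I
    · simpa [hv] using congrArg Fin.val (h1 ⟨v, hv⟩)
    · simp [hv, h2 v hv]

theorem run_entangle (k : V ⊕ F → ZMod 2) (l : List (Sym2 V)) (A : Matrix (V → Fin 2) X ℂ) :
    run k (l.map fun e => Command.entangle e.out.1 e.out.2) A = Matrix.of fun z x =>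
      (l.map fun e => open Classical in if ∀ u ∈ e, z u = 1 then (-1 : ℂ) else 1).prod * A z x := by
  induction l generalizing A with
  | nil => ext z x; simp
  | cons e l ih =>
    rw [List.map_cons, run_cons, ih]
    ext z x
    rw [of_apply, of_apply, Command.op, cz_mul_apply, List.map_cons, List.prod_cons]
    have h : (open Classical in if ∀ u ∈ e, z u = 1 then (-1 : ℂ) else 1) =
        czSign (z e.out.1) (z e.out.2) := by
      classical
      rw [← ite_forall_mem_edge z]
      have : s(e.out.1, e.out.2) = e := Quot.out_eq e
      simp only [this]
    rw [h]
    ring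

/-! ### Pauli corrections -/

theorem run_corrX (k : V ⊕ F → ZMod 2) (u : V ⊕ F) (l : List V) (A : Matrix (V → Fin 2) X ℂ) :
    run k (l.map fun j => .corrX j {u}) A =
      pauliAct (if k u = 1 then (l.map fun j => Pi.single j 1).sum else 0) 0 A := by
  induction l generalizing A with
  | nil => simp
  | cons j l ih =>
    rw [List.map_cons, run_cons, ih]
    by_cases h : k u = 1
    · simp [Command.op, h, onQubit_pauliX_mul, pauliAct_pauliAct]
    · simp [Command.op, h]

theorem run_corrZ (k : V ⊕ F → ZMod 2) (u : V ⊕ F) (l : List V) (A : Matrix (V → Fin 2) X ℂ) :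
    run k (l.map fun j => .corrZ j {u}) A =
      pauliAct 0 (if k u = 1 then (l.map fun j => Pi.single j 1).sum else 0) A := by
  induction l generalizing A with
  | nil => simp
  | cons j l ih =>
    rw [List.map_cons, run_cons, ih]
    by_cases h : k u = 1
    · simp [Command.op, h, onQubit_pauliZ_mul, pauliAct_pauliAct]
    · simp [Command.op, h]

/-! ### Partially measured graph states -/

variable [Fintype F] [DecidableEq F]

/-- The state of the register after the nodes outside the live qubits `L` have been projected onto
the effects `β`, starting from the state `Γ` of the register extended by the fusion nodes. Qubits
which are no longer alive are in the state `|0⟩`. -/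
def partialState (L : Finset V) (β : V ⊕ F → Fin 2 → ℂ) (Γ : Matrix (V ⊕ F → Fin 2) X ℂ) :
    Matrix (V → Fin 2) X ℂ :=
  fun z x => if ∀ i, i ∉ L → z i = 0 then
    ∑ w : V ⊕ F → Fin 2, if ∀ j ∈ L, w (.inl j) = z j then
      (∏ u ∈ (L.disjSum ∅)ᶜ, β u (w u)) * Γ w x else 0
  else 0

theorem partialState_smul (L : Finset V) (β : V ⊕ F → Fin 2 → ℂ) (c : ℂ)
    (Γ : Matrix (V ⊕ F → Fin 2) X ℂ) : partialState L β (c • Γ) = c • partialState L β Γ := by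
  ext z x
  rw [Matrix.smul_apply, partialState, partialState]
  split_ifs
  · rw [smul_eq_mul, Finset.mul_sum]
    refine Finset.sum_congr rfl fun w _ => ?_
    split_ifs
    · rw [Matrix.smul_apply, smul_eq_mul]; ring
    · simp
  · simp

/-- Measuring a live qubit projects it onto the corresponding effect. -/
theorem measure_mul_partialState (L : Finset V) (β : V ⊕ F → Fin 2 → ℂ)
    (Γ : Matrix (V ⊕ F → Fin 2) X ℂ) (i : V) (hi : i ∈ L) :
    onQubit i (vecMulVec ket0 (β (.inl i))) * partialState L β Γ =
      partialState (L.erase i) β Γ := by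
  have hL : ((L.erase i).disjSum (∅ : Finset F))ᶜ =
      insert (.inl i) (L.disjSum (∅ : Finset F))ᶜ := by
    ext (v | f) <;> simp
  ext z x
  rw [onQubit_mul_apply, partialState, hL]
  have h0 : ∀ b, (∀ j, j ∉ L → Function.update z i b j = 0) ↔ ∀ j, j ∉ L → z j = 0 :=
    fun b => forall_congr' fun j => imp_congr_right fun hj => by
      rw [Function.update_of_ne]; rintro rfl; exact hj hi
  simp only [partialState, h0, vecMulVec_apply]
  by_cases hz : z i = 0
  swap
  · rw [if_neg fun h => hz (h i (by simp))]
    refine Finset.sum_eq_zero fun b _ => ?_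
    have : z i = 1 := by
      generalize z i = b at hz
      fin_cases b <;> simp_all
    simp [this, ket0]
  have h1 : (∀ j, j ∉ L.erase i → z j = 0) ↔ ∀ j, j ∉ L → z j = 0 := by
    refine forall_congr' fun j => ?_
    by_cases hj : j = i
    · subst hj; simp [hz]
    · simp [hj]
  simp only [h1]
  split_ifs
  swap
  · simp
  simp only [Finset.mul_sum]
  rw [Finset.sum_comm]
  refine Finset.sum_congr rfl fun w _ => ?_
  have h2 : ∀ b, (∀ j ∈ L, w (.inl j) = Function.update z i b j) ↔
      w (.inl i) = b ∧ ∀ j ∈ L.erase i, w (.inl j) = z j := by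
    intro b
    constructor
    · intro h
      refine ⟨by simpa using h i hi, fun j hj => ?_⟩
      rw [h j (Finset.mem_of_mem_erase hj), Function.update_of_ne (Finset.ne_of_mem_erase hj)]
    · rintro ⟨h, h'⟩ j hj
      by_cases hji : j = i
      · subst hji; simp [h]
      · rw [h' j (Finset.mem_erase.2 ⟨hji, hj⟩), Function.update_of_ne hji]
  simp only [h2]
  split_ifs with h
  · rw [Finset.sum_eq_single (w (.inl i))]
    · rw [if_pos ⟨rfl, h⟩, Finset.prod_insert (by simpa using hi), hz]
      simp [ket0]; ring
    · intro b _ hb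
      rw [if_neg fun h => hb h.1.symm, mul_zero]
    · simp
  · exact Finset.sum_eq_zero fun b _ => by rw [if_neg fun h' => h h'.2, mul_zero]

/-- A Pauli operator on the live qubits commutes with the projections of the other nodes. -/
theorem pauliAct_partialState (L : Finset V) (β : V ⊕ F → Fin 2 → ℂ)
    (Γ : Matrix (V ⊕ F → Fin 2) X ℂ) (a b : V → Fin 2) (ha : ∀ j, j ∉ L → a j = 0)
    (hb : ∀ j, j ∉ L → b j = 0) :
    pauliAct a b (partialState L β Γ) =
      partialState L β (pauliAct (Sum.elim a 0) (Sum.elim b 0) Γ) := by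
  ext z x
  have h0 : (∀ i, i ∉ L → (z + a) i = 0) ↔ ∀ i, i ∉ L → z i = 0 :=
    forall_congr' fun i => imp_congr_right fun hi => by simp [ha i hi]
  simp only [pauliAct, partialState, h0]
  split_ifs
  swap
  · simp
  rw [Finset.mul_sum, ← Equiv.sum_comp (Equiv.addRight (Sum.elim a 0 : V ⊕ F → Fin 2))]
  refine Finset.sum_congr rfl fun w _ => ?_
  have h1 : (∀ j ∈ L, (w + (Sum.elim a 0 : V ⊕ F → Fin 2)) (.inl j) = (z + a) j) ↔
      ∀ j ∈ L, w (.inl j) = z j :=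
    forall₂_congr fun j _ => by simp
  simp only [Equiv.coe_addRight, h1]
  split_ifs with h
  swap
  · simp
  have h2 : ∀ u ∈ (L.disjSum (∅ : Finset F))ᶜ,
      β u ((w + (Sum.elim a 0 : V ⊕ F → Fin 2)) u) = β u (w u) := by
    rintro (v | f) hu
    · simp [ha v (by simpa using hu)]
    · simp
  have h3 : pairing (Sum.elim b 0) (w + (Sum.elim a 0 : V ⊕ F → Fin 2)) = pairing b (z + a) := by
    rw [pairing, Fintype.prod_sum_type, pairing]
    simp only [Sum.elim_inl, Sum.elim_inr, Pi.zero_apply, czSign_zero_left, Finset.prod_const_one,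
      mul_one, Pi.add_apply]
    refine Finset.prod_congr rfl fun j _ => ?_
    by_cases hj : j ∈ L
    · rw [h j hj]
    · simp [hb j hj]
  rw [Finset.prod_congr rfl h2, h3]
  ring

/-- If the Pauli operator `X^a Z^b` turns the effects `β` into phases times `β'` on all projected
nodes and is trivial on the live qubits, it only contributes a phase. -/
theorem exists_partialState_pauliAct (L : Finset V) (β β' : V ⊕ F → Fin 2 → ℂ)
    (Γ : Matrix (V ⊕ F → Fin 2) X ℂ) (a b : V ⊕ F → Fin 2)
    (hL : ∀ j ∈ L, a (.inl j) = 0 ∧ b (.inl j) = 0)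
    (hβ : ∀ u ∈ (L.disjSum (∅ : Finset F))ᶜ,
      ∃ c : ℂ, ‖c‖ = 1 ∧ ∀ t, β u (t + a u) * czSign (b u) t = c * β' u t) :
    ∃ c : ℂ, ‖c‖ = 1 ∧ partialState L β (pauliAct a b Γ) = c • partialState L β' Γ := by
  choose! c hc hβ using hβ
  refine ⟨∏ u ∈ (L.disjSum (∅ : Finset F))ᶜ, c u, ?_, ?_⟩
  · rw [norm_prod]; exact Finset.prod_eq_one hc
  ext z x
  rw [Matrix.smul_apply, partialState, partialState]
  split_ifs
  swap
  · simp
  rw [smul_eq_mul, Finset.mul_sum, ← Equiv.sum_comp (Equiv.addRight a)]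
  refine Finset.sum_congr rfl fun w _ => ?_
  have h1 : (∀ j ∈ L, (w + a) (.inl j) = z j) ↔ ∀ j ∈ L, w (.inl j) = z j :=
    forall₂_congr fun j hj => by simp [(hL j hj).1]
  simp only [Equiv.coe_addRight, h1, pauliAct, register_add_add_cancel]
  split_ifs
  swap
  · simp
  have h2 : pairing b w = ∏ u ∈ (L.disjSum (∅ : Finset F))ᶜ, czSign (b u) (w u) := by
    rw [pairing, ← Finset.prod_mul_prod_compl (L.disjSum (∅ : Finset F)),
      Finset.prod_eq_one, one_mul]
    rintro (v | f) hu
    · simp [(hL v (by simpa using hu)).2]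
    · simp at hu
  rw [h2, ← mul_assoc, ← Finset.prod_mul_distrib, ← mul_assoc, ← Finset.prod_mul_distrib]
  exact congrArg (· * _) (Finset.prod_congr rfl fun u hu => by simpa using hβ u hu (w u))

end Commands

/-! ### Pauli operators compensating measurement outcomes -/

/-- The Pauli operator `X^a Z^b` turns the effect of the outcome `κ` of a measurement with label `l`
into the effect of the outcome `0`, up to a phase, as expressed by linear conditions on the
exponents. -/
def Compensates (l : MeasLabel) (κ a b : Fin 2) : Prop :=
  match l with
  | .XY => a = 0 ∧ b = κ
  | .XZ => a = κ ∧ b = κ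
  | .YZ => a = κ ∧ b = 0
  | .X => b = κ
  | .Y => a + b = κ
  | .Z => a = κ

theorem compensates_zero (l : MeasLabel) : Compensates l 0 0 0 := by
  cases l <;> simp [Compensates]

/-- Compensation is linear, so the corrections of different nodes can be treated separately. -/
theorem Compensates.add {l : MeasLabel} {κ a b κ' a' b' : Fin 2} (h : Compensates l κ a b)
    (h' : Compensates l κ' a' b') : Compensates l (κ + κ') (a + a') (b + b') := by
  cases l
  · exact ⟨by rw [h.1, h'.1, add_zero], congrArg₂ _ h.2 h'.2⟩
  · exact ⟨congrArg₂ _ h.1 h'.1, congrArg₂ _ h.2 h'.2⟩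
  · exact ⟨congrArg₂ _ h.1 h'.1, by rw [h.2, h'.2, add_zero]⟩
  · exact congrArg₂ _ h h'
  · exact (add_add_add_comm a a' b b').trans (congrArg₂ _ h h')
  · exact congrArg₂ _ h h'

/-- The outcome `k` as an exponent. -/
def outcomeBit (k : ZMod 2) : Fin 2 := if k = 1 then 1 else 0

/-- The defining property of `Compensates`: the effect of outcome `k`, precomposed with `X^a Z^b`,
is the effect of outcome `0` up to a phase. -/
theorem exists_phase_measBra (l : MeasLabel) (α : ℝ) (k : ZMod 2) (a b : Fin 2)
    (h : Compensates l (outcomeBit k) a b) :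
    ∃ c : ℂ, ‖c‖ = 1 ∧
      ∀ t, measBra l α k (t + a) * czSign b t = c * measBra l α 0 t := by
  have hs : (starRingEnd ℂ) rsqrt2 = rsqrt2 := star_rsqrt2
  rcases zmod_two_cases k with rfl | rfl
  · simp only [outcomeBit, zero_ne_one, if_false] at h
    cases l
    · obtain ⟨rfl, rfl⟩ := h
      exact ⟨1, by simp, fun t => by simp⟩
    · obtain ⟨rfl, rfl⟩ := h
      exact ⟨1, by simp, fun t => by simp⟩
    · obtain ⟨rfl, rfl⟩ := h
      exact ⟨1, by simp, fun t => by simp⟩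
    · obtain rfl : b = 0 := h
      refine ⟨1, by simp, fun t => ?_⟩
      fin_cases a <;> fin_cases t <;> simp [measBra, measKet, ketX, ket0, ket1]
    · obtain rfl : a = b := (by decide : ∀ a b : Fin 2, a + b = 0 → a = b) a b h
      refine ⟨if a = 1 then -Complex.I else 1, by split_ifs <;> simp, fun t => ?_⟩
      fin_cases a <;> fin_cases t <;> simp [measBra, measKet, ketY, ket0, ket1, czSign, hs]
      · ring
      · linear_combination (-rsqrt2) * Complex.I_mul_I
    · obtain rfl : a = 0 := h
      refine ⟨1, by simp, fun t => ?_⟩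
      fin_cases b <;> fin_cases t <;> simp [measBra, measKet, ketZ, ket0]
  · simp only [outcomeBit, if_true] at h
    cases l
    · obtain ⟨rfl, rfl⟩ := h
      refine ⟨1, by simp, fun t => ?_⟩
      fin_cases t <;> simp [measBra, measKet, ket0, ket1, czSign, hs]
    · obtain ⟨rfl, rfl⟩ := h
      refine ⟨-Complex.I, by simp, fun t => ?_⟩
      fin_cases t <;> simp [measBra, measKet, ketY, ket0, ket1, czSign, hs]
      · ring
      · linear_combination (rsqrt2 ^ 2 * (1 - (starRingEnd ℂ) (phase α))) * Complex.I_mul_I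
    · obtain ⟨rfl, rfl⟩ := h
      refine ⟨1, by simp, fun t => ?_⟩
      fin_cases t <;> simp [measBra, measKet, ketX, ket0, ket1, czSign, hs]
    · obtain rfl : b = 1 := h
      refine ⟨if a = 1 then -1 else 1, by split_ifs <;> simp, fun t => ?_⟩
      fin_cases a <;> fin_cases t <;> simp [measBra, measKet, ketX, ket0, ket1, czSign, hs]
    · obtain rfl : a = b + 1 := (by decide : ∀ a b : Fin 2, a + b = 1 → a = b + 1) a b h
      refine ⟨if b = 0 then Complex.I else 1, by split_ifs <;> simp, fun t => ?_⟩
      fin_cases b <;> fin_cases t <;> simp [measBra, measKet, ketY, ket0, ket1, czSign, hs]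
      · ring
      · linear_combination rsqrt2 * Complex.I_mul_I
    · obtain rfl : a = 1 := h
      refine ⟨1, by simp, fun t => ?_⟩
      fin_cases b <;> fin_cases t <;> simp [measBra, measKet, ketZ, ket0, ket1, czSign]

/-- In a Pauli flow, the correcting operator of `v` compensates the outcome at `v`. -/
theorem IsPauliFlow.compensates_self {N : Type*} [Fintype N] {M : LabelledOpenGraph N}
    {p : {v // v ∉ M.O} → Finset N} {lt : N → N → Prop} (h : IsPauliFlow M p lt)
    (v : {v // v ∉ M.O}) :
    Compensates (M.label v) 1 (bits (p v) v.1) (bits (oddNbhd M.graph (p v)) v.1) := by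
  cases hl : M.label v
  · have := h.label_XY v hl
    exact ⟨bits_of_notMem this.1, bits_of_mem this.2⟩
  · have := h.label_XZ v hl
    exact ⟨bits_of_mem this.1, bits_of_mem this.2⟩
  · have := h.label_YZ v hl
    exact ⟨bits_of_mem this.1, bits_of_notMem this.2⟩
  · exact bits_of_mem (h.label_X v hl)
  · rcases h.label_Y v hl with this | this
    · simp [Compensates, bits, this.1, this.2]
    · simp [Compensates, bits, this.1, this.2]
  · exact bits_of_mem (h.label_Z v hl)

theorem compensates_Y_zero {N : Type*} {K K' : Finset N} {w : N} (h : w ∈ K ↔ w ∈ K') :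
    Compensates .Y 0 (bits K w) (bits K' w) := by
  by_cases hw : w ∈ K'
  · simp [Compensates, bits, h, hw]
  · simp [Compensates, bits, h, hw]

/-- In a Pauli flow, the correcting operator of `v` leaves the effects of earlier measurements
invariant up to a phase. -/
theorem IsPauliFlow.compensates_of_not_lt {N : Type*} [Fintype N] {M : LabelledOpenGraph N}
    {p : {v // v ∉ M.O} → Finset N} {lt : N → N → Prop} (h : IsPauliFlow M p lt)
    {v w : {v // v ∉ M.O}} (hvw : w ≠ v) (hlt : ¬ lt v.1 w.1) :
    Compensates (M.label w) 0 (bits (p v) w.1) (bits (oddNbhd M.graph (p v)) w.1) := by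
  have hne : w.1 ≠ v.1 := fun h => hvw (Subtype.ext h)
  have hX : M.label w ≠ .X → M.label w ≠ .Y → bits (p v) w.1 = 0 := fun h1 h2 =>
    bits_of_notMem fun hw => hlt (h.flow_X v _ hw hne fun _ => ⟨h1, h2⟩)
  have hZ : M.label w ≠ .Y → M.label w ≠ .Z → bits (oddNbhd M.graph (p v)) w.1 = 0 := fun h1 h2 =>
    bits_of_notMem fun hw => hlt (h.flow_Z v _ hw hne fun _ => ⟨h1, h2⟩)
  have hY := h.flow_Y v w hvw hlt
  cases hl : M.label w <;> simp only [hl, ne_eq, reduceCtorEq, not_false_eq_true, not_true,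
    forall_const, false_implies] at hX hZ hY
  · exact ⟨hX, hZ⟩
  · exact ⟨hX, hZ⟩
  · exact ⟨hX, hZ⟩
  · exact hZ
  · exact compensates_Y_zero hY
  · exact hX

namespace XYFusionNetwork

variable {V F : Type*} (N : XYFusionNetwork V F)

/-! ### The graph state of the target open graph -/

open Classical in
/-- The labels of the target open graph as a total function; the value at outputs is not used. -/
def nodeLabel (u : V ⊕ F) : MeasLabel :=
  if h : u ∉ N.targetOpenGraph.O then N.targetOpenGraph.label ⟨u, h⟩ else .X

theorem nodeLabel_coe (u : {n // n ∉ N.targetOpenGraph.O}) :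
    N.nodeLabel u.1 = N.targetOpenGraph.label u := dif_pos u.2

theorem nodeLabel_inl (v : {v // v ∉ N.O}) : N.nodeLabel (.inl v.1) = N.label v :=
  N.nodeLabel_coe (N.vertexNode v)

theorem nodeLabel_inr (f : F) : N.nodeLabel (.inr f) = (N.fusionLabel f).toMeas :=
  N.nodeLabel_coe (N.fusionNode f)

open Classical in
/-- The measurement angles as a total function; the value at outputs is not used. -/
def totalAngle (v : V) : ℝ := if h : v ∉ N.O then N.angle ⟨v, h⟩ else 0

/-- The effects on the nodes of the target open graph for the outcomes `k` and the measurement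
angles `θ`. Fusion nodes have a Pauli label, so their angle is irrelevant. -/
def nodeBra (θ : V → ℝ) (k : V ⊕ F → ZMod 2) (u : V ⊕ F) : Fin 2 → ℂ :=
  measBra (N.nodeLabel u) (Sum.elim θ 0 u) (k u)

theorem targetGraph_adj_inr_inl (f : F) (v : V) :
    N.targetGraph.Adj (.inr f) (.inl v) ↔ v = N.fst f ∨ v = N.snd f := Iff.rfl

theorem not_targetGraph_adj_inr_inr (f g : F) : ¬ N.targetGraph.Adj (.inr f) (.inr g) := id

variable [Fintype V] [Fintype F]

/-- A fusion node lies in `Odd(K)` if and only if exactly one of its two qubits lies in `K`. -/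
theorem bits_oddNbhd_inr (K : Finset (V ⊕ F)) (f : F) :
    bits (oddNbhd N.targetGraph K) (.inr f) =
      bits K (.inl (N.fst f)) + bits K (.inl (N.snd f)) := by
  classical
  have h : (Finset.univ.filter fun w => N.targetGraph.Adj (.inr f) w ∧ w ∈ K) =
      ({.inl (N.fst f), .inl (N.snd f)} : Finset (V ⊕ F)).filter (· ∈ K) := by
    ext (v | g)
    · simp [targetGraph_adj_inr_inl]
    · simp [not_targetGraph_adj_inr_inr]
  have hm : (.inr f) ∈ oddNbhd N.targetGraph K ↔
      Odd (({.inl (N.fst f), .inl (N.snd f)} : Finset (V ⊕ F)).filter (· ∈ K)).card := by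
    rw [← h]
    simp only [oddNbhd, Finset.mem_filter, Finset.mem_univ, true_and]
    convert! Iff.rfl
  have hne := N.fst_ne_snd f
  by_cases h1 : Sum.inl (N.fst f) ∈ K <;> by_cases h2 : Sum.inl (N.snd f) ∈ K <;>
    simp [bits, hm, Finset.filter_insert, Finset.filter_singleton, h1, h2, hne, Nat.odd_iff]

/-- Each fusion node contributes the controlled-`Z` gates with the two fused qubits. -/
theorem edgeSign_targetGraph (z : V → Fin 2) (t : F → Fin 2) :
    edgeSign N.targetGraph (Sum.elim z t) = edgeSign N.graph z *
      ∏ f, (czSign (t f) (z (N.fst f)) * czSign (t f) (z (N.snd f))) := by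
  classical
  set φ : F × Bool → Sym2 (V ⊕ F) :=
    fun q => s(.inr q.1, .inl (if q.2 then N.fst q.1 else N.snd q.1)) with hφ
  have hE : N.targetGraph.edgeFinset =
      N.graph.edgeFinset.image (Sym2.map Sum.inl) ∪ Finset.univ.image φ := by
    ext e
    induction e using Sym2.ind with | _ a b =>
    simp only [Finset.mem_union, Finset.mem_image, Finset.mem_univ, true_and,
      SimpleGraph.mem_edgeFinset, SimpleGraph.mem_edgeSet]
    constructor
    · intro h
      have aux : ∀ v f, v = N.fst f ∨ v = N.snd f → ∃ q, φ q = s(.inr f, .inl v) := by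
        rintro v f (rfl | rfl)
        · exact ⟨(f, true), rfl⟩
        · exact ⟨(f, false), rfl⟩
      rcases a with v | f <;> rcases b with w | g
      · exact .inl ⟨s(v, w), h, rfl⟩
      · rw [Sym2.eq_swap]; exact .inr (aux _ _ h)
      · exact .inr (aux _ _ h)
      · exact h.elim
    · rw [← SimpleGraph.mem_edgeSet]
      rintro (⟨e, he, h⟩ | ⟨⟨f, c⟩, h⟩) <;> rw [← h]
      · induction e using Sym2.ind with | _ v w => exact he
      · cases c
        · exact .inr rfl
        · exact .inl rfl
  have hd : Disjoint (N.graph.edgeFinset.image (Sym2.map Sum.inl)) (Finset.univ.image φ) := by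
    rw [Finset.disjoint_left]
    intro e he he'
    simp only [Finset.mem_image, Finset.mem_univ, true_and] at he he'
    obtain ⟨e, -, rfl⟩ := he
    obtain ⟨q, hq⟩ := he'
    have : Sum.inr q.1 ∈ Sym2.map (Sum.inl : V → V ⊕ F) e := by
      rw [← hq, hφ]; exact Sym2.mem_mk_left _ _
    simp at this
  have hinj : Function.Injective φ := by
    rintro ⟨f, c⟩ ⟨g, d⟩ h
    simp only [hφ, Sym2.eq_iff, Sum.inr.injEq, Sum.inl.injEq, reduceCtorEq, false_and,
      or_false] at h
    obtain ⟨rfl, h⟩ := h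
    have hne := N.fst_ne_snd f
    cases c <;> cases d <;> simp_all
  have h1 : edgeSign N.targetGraph (Sum.elim z t) = ∏ e ∈ N.targetGraph.edgeFinset,
      if ∀ u ∈ e, Sum.elim z t u = 1 then (-1 : ℂ) else 1 := by
    rw [edgeSign]; congr!
  rw [h1, hE, Finset.prod_union hd, Finset.prod_image fun _ _ _ _ h => Sym2.map.injective
    Sum.inl_injective h, Finset.prod_image fun _ _ _ _ h => hinj h, Fintype.prod_prod_type]
  congr 1
  · rw [edgeSign]
    refine Finset.prod_congr (by congr!) fun e _ => ?_
    simp [Sym2.mem_map]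
  · refine Finset.prod_congr rfl fun f _ => ?_
    simp only [hφ, ite_forall_mem_edge, Fintype.prod_bool]
    simp

section

variable {V F : Type*}

theorem liftBasis_iff (S : Finset V) (x : {v // v ∈ S} → Fin 2) (w : V ⊕ F → Fin 2) :
    (∀ n : {n : V ⊕ F // n ∈ S.disjSum (∅ : Finset F)}, w n.1 = liftBasis S x n) ↔
      ∀ v : {v // v ∈ S}, w (.inl v.1) = x v := by
  constructor
  · intro h v
    exact h ⟨.inl v.1, by simp⟩
  · rintro h ⟨v | f, hn⟩
    · exact h ⟨v, by simpa using hn⟩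
    · simp at hn

theorem run_preparationCommands [Fintype V] [DecidableEq V] (N : XYFusionNetwork V F)
    (k : V ⊕ F → ZMod 2) :
    run k (N.preparationCommands) (embed N.I) =
      graphState N.graph N.I (rsqrt2 ^ Nat.card {v // v ∉ N.I}) := by
  classical
  have h1 : (embed N.I) = productState N.I N.I 1 := by
    ext z x; rw [embed_apply]; rfl
  rw [preparationCommands, run_append, h1]
  rw [run_prep k N.I _ (Finset.nodup_toList _) (by simp) _ (by simp)]
  rw [run_entangle]
  ext z x
  rw [of_apply, Finset.prod_map_toList, productState, graphState, one_mul]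
  have hS : ∀ v, v ∉ N.I ∪ ((N.I)ᶜ.toList).toFinset → z v = 0 := by simp +contextual
  have hc : ((N.I)ᶜ.toList).length = Nat.card {v // v ∉ N.I} := by
    rw [Finset.length_toList, Nat.card_eq_fintype_card, Fintype.card_subtype]
    congr 1
    ext v; simp
  by_cases h : ∀ v : {v // v ∈ N.I}, z v.1 = x v
  · rw [if_pos ⟨h, hS⟩, if_pos h, hc, mul_comm, edgeSign]
    congr 1
    exact Finset.prod_congr (by congr!) fun _ _ => by congr!
  · rw [if_neg fun h' => h h'.1, if_neg h, mul_zero]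

theorem run_fuse [Fintype V] [DecidableEq V] (N : XYFusionNetwork V F) (k : V ⊕ F → ZMod 2)
    (fs : List F) {X : Type*} (A : Matrix (V → Fin 2) X ℂ) :
    run k (fs.map fun f => .fuse f (N.fst f) (N.snd f) (N.fusionLabel f)) A =
      Matrix.of fun z x => (fs.map fun f => fusionAmplitude (N.fusionLabel f) (k (.inr f))
        (z (N.fst f)) (z (N.snd f))).prod * A z x := by
  induction fs generalizing A with
  | nil => ext z x; simp
  | cons f fs ih =>
    rw [List.map_cons, run_cons, ih]
    ext z x
    rw [of_apply, of_apply, Command.op, fusionKraus_mul_apply, List.map_cons, List.prod_cons]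
    ring

end

variable {V F : Type*} [Fintype V] [Fintype F] (N : XYFusionNetwork V F)

/-- The amplitudes of the graph state of the target open graph, with its inputs identified with
those of the resource graph. -/
def targetState : Matrix (V ⊕ F → Fin 2) ({v // v ∈ N.I} → Fin 2) ℂ :=
  (graphState N.targetGraph (N.I.disjSum ∅)
    (rsqrt2 ^ (Nat.card {v // v ∉ N.I} + Fintype.card F))).submatrix id (liftBasis N.I)

open Classical in
theorem targetState_apply (w : V ⊕ F → Fin 2) (x : {v // v ∈ N.I} → Fin 2) :
    N.targetState w x = if ∀ v : {v // v ∈ N.I}, w (.inl v.1) = x v then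
      rsqrt2 ^ (Nat.card {v // v ∉ N.I} + Fintype.card F) *
        edgeSign N.targetGraph w else 0 := by
  have h := liftBasis_iff N.I x w
  rw [targetState, submatrix_apply, graphState]
  split_ifs with h1 h2 h2
  · rfl
  · exact absurd (h.1 h1) h2
  · exact absurd (h.2 h2) h1
  · rfl

/-- The stabilizer `X_K Z_{Odd(K)}` of the target graph state, up to a sign. -/
theorem exists_pauliAct_targetState (K : Finset (V ⊕ F)) (hK : ∀ w ∈ K, w ∉ N.targetOpenGraph.I) :
    ∃ c : ℂ, ‖c‖ = 1 ∧
      N.targetState = c • pauliAct (bits K) (bits (oddNbhd N.targetGraph K)) N.targetState := by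
  obtain ⟨c, hc, h⟩ := exists_pauliAct_graphState N.targetGraph (N.I.disjSum ∅) _ K hK
  exact ⟨c, hc, congrArg (fun A => A.submatrix id (liftBasis N.I)) h⟩

variable [DecidableEq V]

variable [DecidableEq F]

/-- After the fusions, the register is in the graph state of the target open graph with the fusion
nodes projected onto the effects of their outcomes. -/
theorem run_fuse_eq_partialState (θ : V → ℝ) (k : V ⊕ F → ZMod 2) (fs : List F) (hfs : fs.Nodup)
    (hfs' : ∀ f, f ∈ fs) :
    run k (N.preparationCommands ++
      fs.map fun f => .fuse f (N.fst f) (N.snd f) (N.fusionLabel f)) (embed N.I) =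
      partialState Finset.univ (N.nodeBra θ k) N.targetState := by
  rw [run_append, run_preparationCommands, run_fuse]
  have hp : ∀ g : F → ℂ, (fs.map g).prod = ∏ f, g f := by
    intro g
    rw [← List.prod_toFinset g hfs]
    exact Finset.prod_congr (by ext; simp [hfs']) fun _ _ => rfl
  have hc : ((Finset.univ : Finset V).disjSum (∅ : Finset F))ᶜ = Finset.univ.map .inr := by
    ext (v | f) <;> simp
  ext z x
  rw [of_apply, hp, partialState, if_pos (by simp), hc]
  simp only [fusionAmplitude]
  rw [Finset.prod_univ_sum, Fintype.piFinset_univ, Finset.sum_mul]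
  refine Finset.sum_of_injOn (fun t => (Sum.elim z t : V ⊕ F → Fin 2)) ?_ (by simp) ?_ ?_
  · intro t _ t' _ h
    ext f
    exact congrArg Fin.val (congrFun h (.inr f))
  · intro w _ hw
    rw [if_neg]
    intro h
    refine hw ⟨fun f => w (.inr f), by simp, ?_⟩
    ext (v | f)
    · exact congrArg Fin.val (h v (Finset.mem_univ v)).symm
    · rfl
  · intro t _
    rw [if_pos (by simp), targetState_apply, edgeSign_targetGraph, graphState]
    by_cases h : ∀ v : {v // v ∈ N.I}, z v.1 = x v
    · rw [if_pos h, if_pos (show ∀ v : {v // v ∈ N.I}, (Sum.elim z t : V ⊕ F → Fin 2) (.inl v.1) =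
        x v from h)]
      simp only [Finset.prod_map, Function.Embedding.inr_apply, Sum.elim_inr, nodeBra,
        nodeLabel_inr, Finset.prod_mul_distrib, Finset.prod_const, Finset.card_univ, pow_add,
        Pi.zero_apply]
      ring
    · rw [if_neg h, if_neg (show ¬ ∀ v : {v // v ∈ N.I}, (Sum.elim z t : V ⊕ F → Fin 2)
        (.inl v.1) = x v from h), mul_zero, mul_zero]

/-! ### Corrections of a node -/

/-- The exponents on the register of a Pauli operator supported on `K ∩ S`, applied for the
outcome `k = 1`. -/
def correctionBits (k : ZMod 2) (K : Finset (V ⊕ F)) (S : Finset V) : V → Fin 2 :=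
  fun j => if k = 1 ∧ j ∈ S then bits K (.inl j) else 0

theorem run_corrections (p : {n // n ∉ N.targetOpenGraph.O} → Finset (V ⊕ F)) (k : V ⊕ F → ZMod 2)
    (u : {n // n ∉ N.targetOpenGraph.O}) (S : Finset V) {X : Type*}
    (A : Matrix (V → Fin 2) X ℂ) :
    run k (N.corrections p u S) A = pauliAct (correctionBits (k u.1) (p u) S)
      (correctionBits (k u.1) (oddNbhd N.targetGraph (p u)) S) A := by
  rw [corrections, run_append, run_corrZ, run_corrX, sum_single_toList, sum_single_toList,
    pauliAct_pauliAct, pairing_zero_left, one_smul, zero_add, add_zero]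
  congr 1 <;>
  · funext j
    by_cases h : k u.1 = 1 <;> by_cases hj : j ∈ S <;> simp [correctionBits, h, hj, bits]

/-! ### Flow conditions as compensation of outcomes -/

section

variable {V F : Type*} [Fintype V] [Fintype F] {N : XYFusionNetwork V F}
  {p : {n // n ∉ N.targetOpenGraph.O} → Finset (V ⊕ F)} {lt : V ⊕ F → V ⊕ F → Prop}

theorem IsXYFlow.compensates_self (h : N.IsXYFlow p lt) (u : {n // n ∉ N.targetOpenGraph.O}) :
    Compensates (N.nodeLabel u.1) 1 (bits (p u) u.1)
      (bits (oddNbhd N.targetGraph (p u)) u.1) := by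
  rw [nodeLabel_coe]
  exact h.pauliFlow.compensates_self u

/-- No correction needs to be made on a fusion node: the correcting operator of any other node fixes
its effects up to a phase. -/
theorem IsXYFlow.compensates_fusion (h : N.IsXYFlow p lt) (u : {n // n ∉ N.targetOpenGraph.O})
    (f : F) (hf : .inr f ≠ u.1) :
    Compensates (N.nodeLabel (.inr f)) 0 (bits (p u) (.inr f))
      (bits (oddNbhd N.targetGraph (p u)) (.inr f)) := by
  have hne : u ≠ N.fusionNode f := fun h => hf (h ▸ rfl)
  rw [nodeLabel_inr]
  cases hl : N.fusionLabel f
  · exact bits_of_notMem (h.fusion_X f hl u hne)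
  · exact compensates_Y_zero (h.fusion_Y f hl u hne)

theorem IsXYFlow.compensates_vertex (h : N.IsXYFlow p lt) {v w : {v // v ∉ N.O}} (hvw : w ≠ v)
    (hlt : ¬ lt (.inl v.1) (.inl w.1)) :
    Compensates (N.nodeLabel (.inl w.1)) 0 (bits (p (N.vertexNode v)) (.inl w.1))
      (bits (oddNbhd N.targetGraph (p (N.vertexNode v))) (.inl w.1)) := by
  rw [nodeLabel_inl]
  refine h.pauliFlow.compensates_of_not_lt (v := N.vertexNode v) (w := N.vertexNode w) ?_ hlt
  intro h
  exact hvw (Subtype.ext (Sum.inl_injective (congrArg Subtype.val h)))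

end

/-! ### Measurement steps with arbitrary angles and live qubits -/

section

variable {V F : Type*} [Fintype V] [Fintype F] [DecidableEq V] (N : XYFusionNetwork V F)
  (p : {n // n ∉ N.targetOpenGraph.O} → Finset (V ⊕ F))

/-- The measurements with angles `θ` in the order of the list, each followed by its corrections on
the qubits later in the list and on the qubits in `R`, which are not measured. -/
def measurementSteps (θ : V → ℝ) (R : Finset V) : List {v // v ∉ N.O} → List (Command V F)
  | [] => []
  | i :: rest =>
      .measure i.1 (N.label i) (θ i.1) ::
        (N.corrections p (N.vertexNode i) ((rest.map Subtype.val).toFinset ∪ R) ++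
          measurementSteps θ R rest)

theorem measurementCommands_eq_measurementSteps (vs : List {v // v ∉ N.O}) :
    N.measurementCommands p vs = N.measurementSteps p N.totalAngle N.O vs := by
  induction vs with
  | nil => rfl
  | cons i rest ih =>
    have : N.totalAngle i.1 = N.angle i := dif_pos i.2
    rw [measurementCommands, measurementSteps, ih, this]

end

variable {V F : Type*} [Fintype V] [Fintype F] [DecidableEq V] [DecidableEq F]
  (N : XYFusionNetwork V F)

/-! ### The correction invariant -/

/-- The register is, up to a phase, in the target graph state with the nodes outside `L` projected
onto the effects of their outcomes, where a Pauli operator `X^a Z^b` has been inserted which is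
trivial on the live qubits `L`. It compensates the outcomes of the projected nodes in `P`, those
whose corrections have been applied, and fixes the effects of the other ones up to a phase. -/
def Reached (θ : V → ℝ) (k : V ⊕ F → ZMod 2) (L : Finset V) (P : Finset (V ⊕ F))
    (A : Matrix (V → Fin 2) ({v // v ∈ N.I} → Fin 2) ℂ) : Prop :=
  ∃ (c : ℂ) (a b : V ⊕ F → Fin 2), ‖c‖ = 1 ∧ (∀ j ∈ L, a (.inl j) = 0 ∧ b (.inl j) = 0) ∧
    (∀ u ∈ (L.disjSum (∅ : Finset F))ᶜ,
      Compensates (N.nodeLabel u) (if u ∈ P then outcomeBit (k u) else 0) (a u) (b u)) ∧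
    A = c • partialState L (N.nodeBra θ k) (pauliAct a b N.targetState)

variable {N}

/-- A freshly measured qubit carries no Pauli operator, so measuring keeps the invariant as long as
its outcome does not count as compensated. -/
theorem Reached.measure {θ : V → ℝ} {k : V ⊕ F → ZMod 2} {L : Finset V} {P : Finset (V ⊕ F)}
    {A : Matrix (V → Fin 2) ({v // v ∈ N.I} → Fin 2) ℂ} (h : N.Reached θ k L P A)
    (i : {v // v ∉ N.O}) (hi : i.1 ∈ L) (hP : .inl i.1 ∉ P) :
    N.Reached θ k (L.erase i.1) P
      (Command.op k (.measure i.1 (N.label i) (θ i.1) : Command V F) * A) := by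
  obtain ⟨c, a, b, hc, hL, hD, rfl⟩ := h
  refine ⟨c, a, b, hc, fun j hj => hL j (Finset.mem_of_mem_erase hj), fun u hu => ?_, ?_⟩
  · by_cases hui : u = .inl i.1
    · subst hui
      rw [if_neg hP, (hL _ hi).1, (hL _ hi).2]
      exact compensates_zero _
    · refine hD u ?_
      rcases u with v | f
      · have hv : v ≠ i.1 := fun h => hui (h ▸ rfl)
        simpa [hv] using hu
      · simp
  · have : N.nodeBra θ k (.inl i.1) = measBra (N.label i) (θ i.1) (k (.inl i.1)) := by
      rw [nodeBra, nodeLabel_inl]; rfl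
    rw [Matrix.mul_smul, Command.op, ← this, measure_mul_partialState _ _ _ _ hi]

/-- The corrections of a node `u` on all live qubits, completed to a stabilizer of the graph state,
leave a Pauli operator on the projected nodes which compensates the outcome at `u` and
fixes the effects of the others up to a phase. -/
theorem Reached.corrections {p : {n // n ∉ N.targetOpenGraph.O} → Finset (V ⊕ F)} {θ : V → ℝ}
    {k : V ⊕ F → ZMod 2} {L : Finset V} {P : Finset (V ⊕ F)}
    {A : Matrix (V → Fin 2) ({v // v ∈ N.I} → Fin 2) ℂ} (h : N.Reached θ k L P A)
    (u : {n // n ∉ N.targetOpenGraph.O}) (huP : u.1 ∉ P)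
    (hrange : ∀ w ∈ p u, w ∉ N.targetOpenGraph.I)
    (hself : Compensates (N.nodeLabel u.1) 1 (bits (p u) u.1)
      (bits (oddNbhd N.targetGraph (p u)) u.1))
    (hother : ∀ w ∈ (L.disjSum (∅ : Finset F))ᶜ, w ≠ u.1 → Compensates (N.nodeLabel w) 0
      (bits (p u) w) (bits (oddNbhd N.targetGraph (p u)) w)) :
    N.Reached θ k L (insert u.1 P) (run k (N.corrections p u L) A) := by
  obtain ⟨c, a, b, hc, hL, hD, rfl⟩ := h
  rw [run_corrections]
  by_cases hk : k u.1 = 1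
  · obtain ⟨c', hc', hS⟩ := N.exists_pauliAct_targetState (p u) hrange
    set K := p u
    set K' := oddNbhd N.targetGraph K
    have h0 : ∀ K : Finset (V ⊕ F), ∀ j, j ∉ L → correctionBits (k u.1) K L j = 0 :=
      fun K j hj => if_neg fun h => hj h.2
    have h1 : ∀ K : Finset (V ⊕ F), ∀ j ∈ L, correctionBits (k u.1) K L j = bits K (.inl j) :=
      fun K j hj => if_pos ⟨hk, hj⟩
    have h2 : ∀ K : Finset (V ⊕ F), ∀ w ∈ (L.disjSum (∅ : Finset F))ᶜ,
        (Sum.elim (correctionBits (k u.1) K L) 0 : V ⊕ F → Fin 2) w = 0 := by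
      rintro K (v | f) hw
      · exact h0 K v (by simpa using hw)
      · rfl
    refine ⟨c * c' * pairing b (bits K) *
      pairing (Sum.elim (correctionBits (k u.1) K' L) 0) (bits K + a),
      bits K + a + Sum.elim (correctionBits (k u.1) K L) 0,
      bits K' + b + Sum.elim (correctionBits (k u.1) K' L) 0, ?_, fun j hj => ?_,
      fun w hw => ?_, ?_⟩
    · simp [hc, hc', norm_pairing]
    · simp [h1 _ j hj, hL j hj, fin_two_add_self]
    · simp only [Pi.add_apply, h2 _ w hw, add_zero]
      by_cases hwu : w = u.1
      · subst hwu
        have := hself.add (hD _ hw)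
        rw [if_neg huP, add_zero] at this
        simpa [outcomeBit, hk] using this
      · have := (hother w hw hwu).add (hD w hw)
        rw [zero_add] at this
        simpa [hwu] using this
    -- The full stabilizer is inserted next to `Γ`, where it cancels the corrections on `L`.
    · conv_lhs => rw [hS]
      simp only [pauliAct_smul, partialState_smul, pauliAct_pauliAct, smul_smul,
        pauliAct_partialState L _ _ _ _ (h0 K) (h0 K')]
      congr 1
      ring
  · have h0 : ∀ K : Finset (V ⊕ F), correctionBits (k u.1) K L = 0 :=
      fun K => funext fun j => if_neg fun h => hk h.1
    rw [h0, h0, pauliAct_zero]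
    refine ⟨c, a, b, hc, hL, fun w hw => ?_, rfl⟩
    by_cases hwu : w = u.1
    · subst hwu
      simpa [huP, outcomeBit, hk] using hD _ hw
    · simpa [hwu] using hD w hw

/-- Once all outcomes are compensated, the state does not depend on them up to a phase. -/
theorem Reached.exists_eq_smul {θ : V → ℝ} {k : V ⊕ F → ZMod 2} {L : Finset V}
    {P : Finset (V ⊕ F)} {A : Matrix (V → Fin 2) ({v // v ∈ N.I} → Fin 2) ℂ}
    (h : N.Reached θ k L P A) (hP : (L.disjSum (∅ : Finset F))ᶜ ⊆ P) :
    ∃ c : ℂ, ‖c‖ = 1 ∧ A = c • partialState L (N.nodeBra θ 0) N.targetState := by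
  obtain ⟨c, a, b, hc, hL, hD, rfl⟩ := h
  obtain ⟨c', hc', h⟩ := exists_partialState_pauliAct L (N.nodeBra θ k) (N.nodeBra θ 0)
    N.targetState a b hL fun u hu => by
      have := hD u hu
      rw [if_pos (hP hu)] at this
      exact exists_phase_measBra _ _ _ _ _ this
  exact ⟨c * c', by simp [hc, hc'], by rw [h, smul_smul]⟩

variable {p : {n // n ∉ N.targetOpenGraph.O} → Finset (V ⊕ F)} {lt : V ⊕ F → V ⊕ F → Prop}

/-- The corrections of all fusions, which act on the whole register. -/
theorem Reached.fusionCorrections (h : N.IsXYFlow p lt) {θ : V → ℝ} {k : V ⊕ F → ZMod 2}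
    (fs : List F) (hfs : fs.Nodup) {P : Finset (V ⊕ F)} (hP : ∀ f ∈ fs, .inr f ∉ P)
    {A : Matrix (V → Fin 2) ({v // v ∈ N.I} → Fin 2) ℂ} (hA : N.Reached θ k Finset.univ P A) :
    N.Reached θ k Finset.univ (P ∪ (fs.map Sum.inr).toFinset)
      (run k (fs.flatMap fun f => N.corrections p (N.fusionNode f) Finset.univ) A) := by
  induction fs generalizing P A with
  | nil => simpa using hA
  | cons f fs ih =>
    rw [List.nodup_cons] at hfs
    rw [List.flatMap_cons, run_append]
    have h1 := hA.corrections (p := p) (N.fusionNode f) (hP f (by simp)) (h.pauliFlow.range _)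
      (h.compensates_self _) (by
        rintro (v | g) hw hne
        · simp at hw
        · exact h.compensates_fusion _ _ hne)
    have h2 := ih hfs.2 (P := insert (.inr f) P) (fun g hg => by
      simp only [Finset.mem_insert, Sum.inr.injEq, not_or]
      exact ⟨fun h => hfs.1 (h ▸ hg), hP g (by simp [hg])⟩) h1
    convert h2 using 1
    ext; simp

/-- The invariant is kept by measurements in an order compatible with the flow. The qubits outside
`vs` and `R` have been measured before, so none of them may be later in the flow order than an
element of `vs`. -/
theorem Reached.measurementSteps (h : N.IsXYFlow p lt) {θ : V → ℝ} {k : V ⊕ F → ZMod 2}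
    {R : Finset V} (hR : N.O ⊆ R) (vs : List {v // v ∉ N.O}) (hvs : vs.Nodup)
    (hvR : ∀ v ∈ vs, v.1 ∉ R)
    (hlt : vs.Pairwise fun v w => ¬ lt (.inl w.1) (.inl v.1))
    (hprev : ∀ v ∈ vs, ∀ w : {v // v ∉ N.O}, w ∉ vs → w.1 ∉ R → ¬ lt (.inl v.1) (.inl w.1))
    {P : Finset (V ⊕ F)} (hP : ∀ v ∈ vs, .inl v.1 ∉ P)
    {A : Matrix (V → Fin 2) ({v // v ∈ N.I} → Fin 2) ℂ}
    (hA : N.Reached θ k ((vs.map Subtype.val).toFinset ∪ R) P A) :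
    N.Reached θ k R (P ∪ (vs.map fun v => .inl v.1).toFinset)
      (run k (N.measurementSteps p θ R vs) A) := by
  induction vs generalizing P A with
  | nil => simpa [XYFusionNetwork.measurementSteps] using hA
  | cons i rest ih =>
    rw [List.nodup_cons] at hvs
    rw [List.pairwise_cons] at hlt
    simp only [List.mem_cons, forall_eq_or_imp] at hvR hP
    rw [XYFusionNetwork.measurementSteps, run_cons, run_append]
    have hirest : i.1 ∉ (rest.map Subtype.val).toFinset := by
      simpa using fun _ => hvs.1
    have h1 := hA.measure i (by simp) hP.1
    have hL : ((((i :: rest).map Subtype.val).toFinset ∪ R).erase i.1) =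
        (rest.map Subtype.val).toFinset ∪ R := by
      rw [List.map_cons, List.toFinset_cons, Finset.insert_union, Finset.erase_insert]
      simp only [Finset.mem_union, not_or]
      exact ⟨hirest, hvR.1⟩
    rw [hL] at h1
    have h2 := h1.corrections (p := p) (N.vertexNode i) hP.1 (h.pauliFlow.range _)
      (h.compensates_self _) (by
        rintro (w | g) hw hne
        · have hw' : w ∉ (rest.map Subtype.val).toFinset ∧ w ∉ R := by
            simpa only [Finset.mem_compl, Finset.inl_mem_disjSum, Finset.mem_union, not_or] using hw
          have hwO : w ∉ N.O := fun h => hw'.2 (hR h)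
          have hwi : (⟨w, hwO⟩ : {v // v ∉ N.O}) ≠ i := fun h => hne (h ▸ rfl)
          refine h.compensates_vertex (w := ⟨w, hwO⟩) hwi (hprev i (by simp) ⟨w, hwO⟩ ?_ hw'.2)
          rw [List.mem_cons, not_or]
          refine ⟨hwi, fun hm => hw'.1 ?_⟩
          simpa using ⟨hwO, hm⟩
        · exact h.compensates_fusion _ _ hne)
    have h3 := ih hvs.2 hvR.2 hlt.2 (fun v hv w hw hwR => by
      by_cases hwi : w = i
      · subst hwi; exact hlt.1 v hv
      · exact hprev v (by simp [hv]) w (by simp [hwi, hw]) hwR) (P := insert (.inl i.1) P)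
      (fun v hv => by
        simp only [Finset.mem_insert, Sum.inl.injEq, not_or]
        exact ⟨fun h => hvs.1 (Subtype.ext h ▸ hv), hP.2 v hv⟩) h2
    convert h3 using 1
    ext; simp

/-- The branch of the pattern which stops after the measurements of `vs`, with corrections
on the remaining qubits `R`. -/
theorem exists_run_measurementSteps (h : N.IsXYFlow p lt) (θ : V → ℝ) (k : V ⊕ F → ZMod 2)
    (fs : List F) (hfs : fs.Nodup) (hfs' : ∀ f, f ∈ fs) {R : Finset V} (hR : N.O ⊆ R)
    (vs : List {v // v ∉ N.O}) (hvs : vs.Nodup) (hvR : ∀ v : {v // v ∉ N.O}, v ∈ vs ↔ v.1 ∉ R)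
    (hlt : vs.Pairwise fun v w => ¬ lt (.inl w.1) (.inl v.1)) :
    ∃ c : ℂ, ‖c‖ = 1 ∧
      run k (N.preparationCommands ++ N.fusionCommands p fs ++ N.measurementSteps p θ R vs)
        (embed N.I) = c • partialState R (N.nodeBra θ 0) N.targetState := by
  have h0 : N.Reached θ k Finset.univ ∅
      (partialState Finset.univ (N.nodeBra θ k) N.targetState) :=
    ⟨1, 0, 0, by simp, by simp, fun u _ => by simpa using compensates_zero _, by simp⟩
  rw [run_append, fusionCommands, ← List.append_assoc, run_append,
    N.run_fuse_eq_partialState θ k fs hfs hfs']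
  have h1 := h0.fusionCorrections h fs hfs (by simp)
  have huniv : (vs.map Subtype.val).toFinset ∪ R = Finset.univ := by
    ext v
    by_cases hv : v ∈ R
    · simp [hv]
    · have hv' : v ∉ N.O := fun h => hv (hR h)
      have := (hvR ⟨v, hv'⟩).2 hv
      simpa [hv] using ⟨hv', this⟩
  rw [← huniv] at h1
  have h2 := h1.measurementSteps h hR vs hvs (fun v hv => (hvR v).1 hv) hlt
    (fun v _ w hw hwR => absurd ((hvR w).2 hwR) hw) (by simp)
  rw [huniv] at h2
  refine h2.exists_eq_smul ?_
  rintro (v | f) hu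
  · have hv : v ∉ R := by simpa using hu
    have hv' : v ∉ N.O := fun h => hv (hR h)
    have := (hvR ⟨v, hv'⟩).2 hv
    simpa using ⟨hv', this⟩
  · simp [hfs' f]

variable (N) in
/-- With all non-outputs projected onto the outcome `0`, the graph state is the target linear map. -/
theorem partialState_eq_embed_mul_targetMap :
    partialState N.O (N.nodeBra N.totalAngle 0) N.targetState = embed N.O * N.targetMap := by
  classical
  ext z x
  rw [mul_apply, partialState]
  split_ifs with hz
  swap
  · refine (Finset.sum_eq_zero fun y _ => ?_).symm
    rw [embed_apply, if_neg fun h => hz h.2, zero_mul]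
  symm
  rw [Finset.sum_eq_single fun v : {v // v ∈ N.O} => z v.1]
  rotate_left
  · intro y _ hy
    rw [embed_apply, if_neg, zero_mul]
    exact fun h => hy (funext fun v => (h.1 v).symm)
  · simp
  rw [embed_apply, if_pos ⟨fun _ => rfl, hz⟩, one_mul]
  symm
  refine Finset.sum_congr (Finset.ext fun _ => by simp) fun w _ => ?_
  rw [targetState_apply]
  have hO : (∀ n : {n // n ∈ N.targetOpenGraph.O}, w n.1 = liftBasis N.O (fun v => z v.1) n) ↔
      ∀ j ∈ N.O, w (.inl j) = z j :=
    (liftBasis_iff N.O _ w).trans Subtype.forall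
  have hI : (∀ n : {n // n ∈ N.targetOpenGraph.I}, w n.1 = liftBasis N.I x n) ↔
      ∀ v : {v // v ∈ N.I}, w (.inl v.1) = x v := liftBasis_iff N.I x w
  by_cases h1 : ∀ j ∈ N.O, w (.inl j) = z j
  swap
  · rw [if_neg h1, if_neg fun h => h1 (hO.1 h.1)]
  by_cases h2 : ∀ v : {v // v ∈ N.I}, w (.inl v.1) = x v
  swap
  · rw [if_pos h1, if_neg h2, mul_zero, if_neg fun h => h2 (hI.1 h.2)]
  rw [if_pos h1, if_pos h2, if_pos ⟨hO.2 h1, hI.2 h2⟩]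
  have hc : (Finset.univ.filter fun v => v ∉ N.targetOpenGraph.I).card =
      Nat.card {v // v ∉ N.I} + Fintype.card F := by
    have : (Finset.univ.filter fun v => v ∉ N.targetOpenGraph.I) =
        (Finset.univ.filter fun v => v ∉ N.I).disjSum Finset.univ := by
      ext (v | f) <;> simp [targetOpenGraph]
    rw [this, Finset.card_disjSum, Finset.card_univ, Nat.card_eq_fintype_card,
      Fintype.card_subtype]
  have hp : ∏ u ∈ (N.O.disjSum (∅ : Finset F))ᶜ, N.nodeBra N.totalAngle 0 u (w u) =
      ∏ i : {v // v ∉ N.targetOpenGraph.O},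
        measBra (N.targetOpenGraph.label i) (N.targetOpenGraph.angle i) 0 (w i.1) := by
    rw [Finset.prod_subtype (p := fun v => v ∉ N.targetOpenGraph.O) _
      (fun u => by rw [Finset.mem_compl]; rfl)]
    refine Finset.prod_congr rfl fun i _ => ?_
    rw [nodeBra, nodeLabel_coe]
    congr 2
    obtain ⟨v | f, hi⟩ := i
    · exact dif_pos (by simpa [targetOpenGraph] using hi)
    · rfl
  rw [hp, mul_assoc, mul_comm (rsqrt2 ^ _), ← hc, edgeSign]
  congr!

end XYFusionNetwork

/-! ### Runnable lists of commands -/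

section Runnable

variable {V F : Type*} [DecidableEq V] [DecidableEq F] {I O : Finset V}

theorem runnableFrom_prep_append (l : List V) (hl : l.Nodup) (hI : ∀ i ∈ l, i ∉ I)
    {live gone : Finset V} (hlive : ∀ i ∈ l, i ∉ live) (hgone : ∀ i ∈ l, i ∉ gone)
    {known : Finset (V ⊕ F)} {cs : List (Command V F)}
    (h : RunnableFrom I O (live ∪ l.toFinset) gone known cs) :
    RunnableFrom I O live gone known (l.map .prep ++ cs) := by
  induction l generalizing live with
  | nil => simpa using h
  | cons i l ih =>
    rw [List.nodup_cons] at hl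
    simp only [List.mem_cons, forall_eq_or_imp] at hI hlive hgone
    refine ⟨hI.1, hlive.1, hgone.1, ih hl.2 hI.2 (fun j hj => ?_) hgone.2 ?_⟩
    · simp only [Finset.mem_insert, not_or]
      exact ⟨fun h => hl.1 (h ▸ hj), hlive.2 j hj⟩
    · convert h using 1
      simp [Finset.insert_union, Finset.union_insert]

theorem runnableFrom_entangle_append [Fintype V] (l : List (Sym2 V)) (hl : ∀ e ∈ l, ¬ e.IsDiag)
    {gone : Finset V} {known : Finset (V ⊕ F)} {cs : List (Command V F)}
    (h : RunnableFrom I O Finset.univ gone known cs) :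
    RunnableFrom I O Finset.univ gone known
      ((l.map fun e => .entangle e.out.1 e.out.2) ++ cs) := by
  induction l with
  | nil => exact h
  | cons e l ih =>
    simp only [List.mem_cons, forall_eq_or_imp] at hl
    refine ⟨fun h => hl.1 ?_, Finset.mem_univ _, Finset.mem_univ _, ih hl.2⟩
    rw [← Quot.out_eq e]
    exact h

/-- Pauli corrections on live qubits that only depend on known outcomes can always be run. -/
theorem runnableFrom_corrections_append {live gone : Finset V} {known : Finset (V ⊕ F)}
    {cs : List (Command V F)} (l : List (Command V F))
    (hl : ∀ c ∈ l, ∃ j t, (c = .corrX j t ∨ c = .corrZ j t) ∧ j ∈ live ∧ t ⊆ known)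
    (h : RunnableFrom I O live gone known cs) : RunnableFrom I O live gone known (l ++ cs) := by
  induction l with
  | nil => exact h
  | cons c l ih =>
    simp only [List.mem_cons, forall_eq_or_imp] at hl
    obtain ⟨⟨j, t, rfl | rfl, hj, ht⟩, hl⟩ := hl
    · exact ⟨hj, ht, ih hl⟩
    · exact ⟨hj, ht, ih hl⟩

end Runnable

/-! ### The commands of the pattern -/

theorem map_withAngles_of_forall_ne {V F : Type*} (θ : V → ℝ) (cs : List (Command V F))
    (h : ∀ c ∈ cs, ∀ i l α, c ≠ .measure i l α) : cs.map (Command.withAngles θ) = cs := by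
  conv_rhs => rw [← List.map_id cs]
  refine List.map_congr_left fun c hc => ?_
  cases c
  case measure i l α => exact absurd rfl (h _ hc i l α)
  all_goals rfl

namespace XYFusionNetwork

section

variable {V F : Type*} [Fintype V] [DecidableEq V] {N : XYFusionNetwork V F}

theorem runnableFrom_preparationCommands [DecidableEq F] {cs : List (Command V F)}
    (h : RunnableFrom N.I N.O Finset.univ ∅ ∅ cs) :
    RunnableFrom N.I N.O N.I ∅ ∅ (N.preparationCommands ++ cs) := by
  rw [preparationCommands, List.append_assoc]
  refine runnableFrom_prep_append _ (Finset.nodup_toList _) (by simp) (by simp) (by simp) ?_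
  have : N.I ∪ (N.Iᶜ.toList).toFinset = Finset.univ := by ext v; simp
  rw [this]
  refine runnableFrom_entangle_append _ (fun e he => ?_) h
  exact N.graph.not_isDiag_of_mem_edgeSet (by simpa using he)

theorem ne_measure_of_mem_preparationCommands {c : Command V F} (hc : c ∈ N.preparationCommands)
    (i : V) (l : MeasLabel) (α : ℝ) : c ≠ .measure i l α := by
  simp only [preparationCommands, List.mem_append, List.mem_map] at hc
  rcases hc with ⟨_, _, rfl⟩ | ⟨_, _, rfl⟩ <;> simp

variable [Fintype F] {p : {n // n ∉ N.targetOpenGraph.O} → Finset (V ⊕ F)}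

theorem exists_of_mem_corrections {u : {n // n ∉ N.targetOpenGraph.O}} {S : Finset V}
    {c : Command V F} (hc : c ∈ N.corrections p u S) :
    ∃ j ∈ S, c = .corrX j {u.1} ∨ c = .corrZ j {u.1} := by
  classical
  simp only [corrections, List.mem_append, List.mem_map, Finset.mem_toList,
    Finset.mem_filter] at hc
  rcases hc with ⟨j, hj, rfl⟩ | ⟨j, hj, rfl⟩
  · exact ⟨j, hj.1, .inr rfl⟩
  · exact ⟨j, hj.1, .inl rfl⟩

theorem ne_measure_of_mem_corrections {u : {n // n ∉ N.targetOpenGraph.O}} {S : Finset V}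
    {c : Command V F} (hc : c ∈ N.corrections p u S) (i : V) (l : MeasLabel) (α : ℝ) :
    c ≠ .measure i l α := by
  obtain ⟨j, _, rfl | rfl⟩ := exists_of_mem_corrections hc <;> simp

theorem ne_measure_of_mem_fusionCommands {fs : List F} {c : Command V F}
    (hc : c ∈ N.fusionCommands p fs) (i : V) (l : MeasLabel) (α : ℝ) : c ≠ .measure i l α := by
  simp only [fusionCommands, List.mem_append, List.mem_map, List.mem_flatMap] at hc
  rcases hc with ⟨_, _, rfl⟩ | ⟨_, _, hc⟩
  · simp
  · exact ne_measure_of_mem_corrections hc i l α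

theorem ne_measure_of_mem_interleavedFusionCommands {fs : List F} {c : Command V F}
    (hc : c ∈ N.interleavedFusionCommands p fs) (i : V) (l : MeasLabel) (α : ℝ) :
    c ≠ .measure i l α := by
  simp only [interleavedFusionCommands, List.mem_flatMap, List.mem_cons] at hc
  rcases hc with ⟨_, _, rfl | hc⟩
  · simp
  · exact ne_measure_of_mem_corrections hc i l α

theorem map_withAngles_measurementSteps (θ θ' : V → ℝ) (R : Finset V)
    (vs : List {v // v ∉ N.O}) :
    (N.measurementSteps p θ' R vs).map (Command.withAngles θ) = N.measurementSteps p θ R vs := by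
  induction vs with
  | nil => rfl
  | cons i rest ih =>
    rw [measurementSteps, measurementSteps, List.map_cons, List.map_append, ih,
      map_withAngles_of_forall_ne _ _ fun c hc => ne_measure_of_mem_corrections hc]
    rfl

end

/-! ### Runnability of the parts of the pattern -/

variable {V F : Type*} [Fintype V] [Fintype F] [DecidableEq V] [DecidableEq F]
  {N : XYFusionNetwork V F} {p : {n // n ∉ N.targetOpenGraph.O} → Finset (V ⊕ F)}

theorem runnableFrom_corrections (u : {n // n ∉ N.targetOpenGraph.O}) {live gone : Finset V}
    {known : Finset (V ⊕ F)} (hu : u.1 ∈ known) {cs : List (Command V F)}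
    (h : RunnableFrom N.I N.O live gone known cs) :
    RunnableFrom N.I N.O live gone known (N.corrections p u live ++ cs) := by
  refine runnableFrom_corrections_append _ (fun c hc => ?_) h
  obtain ⟨j, hj, h⟩ := exists_of_mem_corrections hc
  exact ⟨j, _, h, hj, by simpa using hu⟩

theorem runnableFrom_fusionCommands (fs : List F) (hfs : fs.Nodup) {cs : List (Command V F)}
    (h : ∀ known, RunnableFrom N.I N.O Finset.univ ∅ known cs) :
    RunnableFrom N.I N.O Finset.univ ∅ ∅ (N.fusionCommands p fs ++ cs) := by
  have h1 : ∀ (gs : List F) (known : Finset (V ⊕ F)), (∀ g ∈ gs, .inr g ∈ known) →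
      RunnableFrom N.I N.O Finset.univ ∅ known
        ((gs.flatMap fun f => N.corrections p (N.fusionNode f) Finset.univ) ++ cs) := by
    intro gs known hgs
    induction gs with
    | nil => exact h known
    | cons g gs ih =>
      simp only [List.mem_cons, forall_eq_or_imp] at hgs
      rw [List.flatMap_cons, List.append_assoc]
      exact runnableFrom_corrections _ hgs.1 (ih hgs.2)
  have h2 : ∀ (gs : List F) (known : Finset (V ⊕ F)) (ds : List (Command V F)), gs.Nodup →
      (∀ g ∈ gs, .inr g ∉ known) →
      RunnableFrom N.I N.O Finset.univ ∅ (known ∪ (gs.map Sum.inr).toFinset) ds →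
      RunnableFrom N.I N.O Finset.univ ∅ known
        ((gs.map fun f => .fuse f (N.fst f) (N.snd f) (N.fusionLabel f)) ++ ds) := by
    intro gs
    induction gs with
    | nil => intro known ds _ _ hds; simpa using hds
    | cons g gs ih =>
      intro known ds hgs hk hds
      rw [List.nodup_cons] at hgs
      simp only [List.mem_cons, forall_eq_or_imp] at hk
      refine ⟨N.fst_ne_snd g, Finset.mem_univ _, Finset.mem_univ _, hk.1,
        ih _ _ hgs.2 (fun f hf => ?_) ?_⟩
      · simp only [Finset.mem_insert, Sum.inr.injEq, not_or]
        exact ⟨fun h => hgs.1 (h ▸ hf), hk.2 f hf⟩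
      · convert hds using 1
        ext; simp
  rw [fusionCommands, List.append_assoc]
  exact h2 fs ∅ _ hfs (by simp) (h1 fs _ (by simp))

theorem runnableFrom_interleavedFusionCommands (fs : List F) (hfs : fs.Nodup)
    {cs : List (Command V F)} (h : ∀ known, RunnableFrom N.I N.O Finset.univ ∅ known cs)
    (known : Finset (V ⊕ F)) (hk : ∀ f ∈ fs, .inr f ∉ known) :
    RunnableFrom N.I N.O Finset.univ ∅ known (N.interleavedFusionCommands p fs ++ cs) := by
  induction fs generalizing known with
  | nil => exact h known
  | cons f fs ih =>
    rw [List.nodup_cons] at hfs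
    simp only [List.mem_cons, forall_eq_or_imp] at hk
    rw [interleavedFusionCommands, List.flatMap_cons, List.append_assoc, List.cons_append]
    refine ⟨N.fst_ne_snd f, Finset.mem_univ _, Finset.mem_univ _, hk.1,
      runnableFrom_corrections _ (by simp [fusionNode]) (ih hfs.2 _ fun g hg => ?_)⟩
    simp only [Finset.mem_insert, Sum.inr.injEq, not_or]
    exact ⟨fun h => hfs.1 (h ▸ hg), hk.2 g hg⟩

theorem runnableFrom_measurementCommands (vs : List {v // v ∉ N.O}) (hvs : vs.Nodup)
    (gone : Finset V) (known : Finset (V ⊕ F)) :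
    RunnableFrom N.I N.O ((vs.map Subtype.val).toFinset ∪ N.O) gone known
      (N.measurementCommands p vs) := by
  induction vs generalizing gone known with
  | nil => simp [measurementCommands, RunnableFrom]
  | cons i rest ih =>
    rw [List.nodup_cons] at hvs
    refine ⟨i.2, by simp, ?_⟩
    have hL : ((((i :: rest).map Subtype.val).toFinset ∪ N.O).erase i.1) =
        (rest.map Subtype.val).toFinset ∪ N.O := by
      rw [List.map_cons, List.toFinset_cons, Finset.insert_union, Finset.erase_insert]
      simpa [i.2] using hvs.1
    rw [hL]
    exact runnableFrom_corrections _ (by simp [vertexNode]) (ih hvs.2 _ _)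

/-! ### Truncated patterns -/

/-- An element which does not occur in a prefix of a list occurs after this prefix. -/
theorem exists_of_append_eq_append_cons {α : Type*} {C B pre post : List α} {m : α} (hm : m ∉ C)
    (h : C ++ B = pre ++ m :: post) : ∃ pre', pre = C ++ pre' ∧ B = pre' ++ m :: post := by
  rcases List.append_eq_append_iff.1 h with h' | ⟨bs, rfl, h'⟩
  · exact h'
  · cases bs with
    | nil => exact ⟨[], by simp, h'.symm⟩
    | cons b bs =>
      rw [List.cons_append, List.cons.injEq] at h'
      exact absurd (by simp [h'.1]) hm

theorem filterMap_corrections_self (u : {n // n ∉ N.targetOpenGraph.O}) (S : Finset V)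
    (known : Finset (V ⊕ F)) :
    (N.corrections p u S).filterMap (Command.correctionFor u.1 (insert u.1 known)) =
      N.corrections p u S := by
  conv_rhs => rw [← List.filterMap_some (l := N.corrections p u S)]
  refine List.filterMap_congr fun c hc => ?_
  obtain ⟨j, _, rfl | rfl⟩ := exists_of_mem_corrections hc <;>
    simp [Command.correctionFor, Finset.singleton_inter_of_mem (Finset.mem_insert_self _ _)]

theorem filterMap_corrections_of_ne {u : {n // n ∉ N.targetOpenGraph.O}} {s : V ⊕ F}
    (hs : s ≠ u.1) (S : Finset V) (known : Finset (V ⊕ F)) :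
    (N.corrections p u S).filterMap (Command.correctionFor s known) = [] := by
  rw [List.filterMap_eq_nil_iff]
  intro c hc
  obtain ⟨j, _, rfl | rfl⟩ := exists_of_mem_corrections hc <;>
    simp [Command.correctionFor, hs]

theorem filterMap_measurementSteps (θ : V → ℝ) (R : Finset V) (i : {v // v ∉ N.O})
    (known : Finset (V ⊕ F)) (vs : List {v // v ∉ N.O}) (hi : i ∉ vs) :
    (N.measurementSteps p θ R vs).filterMap (Command.correctionFor (.inl i.1) known) = [] := by
  induction vs with
  | nil => rfl
  | cons v rest ih =>
    rw [List.mem_cons, not_or] at hi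
    have hne : (.inl i.1 : V ⊕ F) ≠ (N.vertexNode v).1 := fun h =>
      hi.1 (Subtype.ext (Sum.inl_injective h))
    rw [measurementSteps, List.filterMap_cons_none rfl, List.filterMap_append, ih hi.2,
      filterMap_corrections_of_ne hne, List.append_nil]

/-- Truncating after a measurement and keeping the corrections for its outcome leaves the
measurements so far, with corrections on all qubits which have not been measured. -/
theorem exists_truncation (θ : V → ℝ) (R : Finset V) (vs : List {v // v ∉ N.O}) (hvs : vs.Nodup)
    {pre post : List (Command V F)} {i : V} {l : MeasLabel} {α : ℝ}
    (h : N.measurementSteps p θ R vs = pre ++ .measure i l α :: post) :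
    ∃ vs₁ v vs₂, vs = vs₁ ++ v :: vs₂ ∧ ∀ known : Finset (V ⊕ F),
      pre ++ .measure i l α ::
        post.filterMap (Command.correctionFor (.inl i) (insert (.inl i) known)) =
      N.measurementSteps p θ ((vs₂.map Subtype.val).toFinset ∪ R) (vs₁ ++ [v]) := by
  induction vs generalizing pre with
  | nil => simp [measurementSteps] at h
  | cons v rest ih =>
    rw [List.nodup_cons] at hvs
    rw [measurementSteps] at h
    cases pre with
    | nil =>
      rw [List.nil_append, List.cons.injEq] at h
      obtain ⟨h1, rfl⟩ := h
      rw [Command.measure.injEq] at h1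
      obtain ⟨rfl, rfl, rfl⟩ := h1
      refine ⟨[], v, rest, rfl, fun known => ?_⟩
      have h2 := filterMap_corrections_self (N := N) (p := p) (N.vertexNode v)
        ((rest.map Subtype.val).toFinset ∪ R) known
      rw [List.filterMap_append, filterMap_measurementSteps θ R v _ rest hvs.1]
      rw [List.nil_append, List.nil_append, measurementSteps, measurementSteps]
      simp only [List.append_nil, List.map_nil, List.toFinset_nil, Finset.empty_union]
      exact congrArg _ h2
    | cons c pre =>
      rw [List.cons_append, List.cons.injEq] at h
      obtain ⟨rfl, h⟩ := h
      obtain ⟨pre', rfl, hpre'⟩ := exists_of_append_eq_append_cons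
        (fun hc => ne_measure_of_mem_corrections hc i l α rfl) h
      obtain ⟨vs₁, w, vs₂, rfl, h'⟩ := ih hvs.2 hpre'
      refine ⟨v :: vs₁, w, vs₂, rfl, fun known => ?_⟩
      have hS : ((vs₁ ++ w :: vs₂).map Subtype.val).toFinset ∪ R =
          ((vs₁ ++ [w]).map Subtype.val).toFinset ∪ ((vs₂.map Subtype.val).toFinset ∪ R) := by
        rw [← Finset.union_assoc, ← List.toFinset_append, ← List.map_append]
        simp
      rw [List.cons_append, List.append_assoc, h' known, List.cons_append, measurementSteps, hS]

/-! ### Fusions directly followed by their corrections -/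

/-- The amplitude of a fusion depends only on the parity of its two qubits. -/
theorem fusionAmplitude_add (l : FusionLabel) (k : ZMod 2) (a b e : Fin 2) :
    fusionAmplitude l k (a + e) (b + e) = fusionAmplitude l k a b := by
  refine Finset.sum_congr rfl fun t _ => ?_
  rw [czSign_add_right, czSign_add_right]
  linear_combination (measBra l.toMeas 0 k t * rsqrt2 * czSign t a * czSign t b) *
    czSign_mul_self t e

/-- The corrections of a node commute with the fusions of pairs of qubits whose parity they do not
change. -/
theorem run_fuse_corrections (k : V ⊕ F → ZMod 2) (u : {n // n ∉ N.targetOpenGraph.O})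
    (gs : List F) (hgs : ∀ g ∈ gs, .inr g ∉ oddNbhd N.targetGraph (p u)) {X : Type*}
    (A : Matrix (V → Fin 2) X ℂ) :
    run k (gs.map fun f => .fuse f (N.fst f) (N.snd f) (N.fusionLabel f))
        (run k (N.corrections p u Finset.univ) A) =
      run k (N.corrections p u Finset.univ)
        (run k (gs.map fun f => .fuse f (N.fst f) (N.snd f) (N.fusionLabel f)) A) := by
  rw [run_corrections, run_corrections, run_fuse, run_fuse]
  ext z x
  set a := correctionBits (k u.1) (p u) Finset.univ with ha
  have h : ∀ g ∈ gs, a (N.fst g) = a (N.snd g) := by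
    intro g hg
    have h1 := N.bits_oddNbhd_inr (p u) g
    rw [bits_of_notMem (hgs g hg)] at h1
    have h2 : bits (p u) (.inl (N.fst g)) = bits (p u) (.inl (N.snd g)) :=
      (by decide : ∀ a b : Fin 2, 0 = a + b → a = b) _ _ h1
    simp [ha, correctionBits, h2]
  rw [of_apply, pauliAct, pauliAct, of_apply]
  have h3 : (gs.map fun f => fusionAmplitude (N.fusionLabel f) (k (.inr f))
      ((z + a) (N.fst f)) ((z + a) (N.snd f))) =
      gs.map fun f => fusionAmplitude (N.fusionLabel f) (k (.inr f))
        (z (N.fst f)) (z (N.snd f)) := by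
    refine List.map_congr_left fun g hg => ?_
    rw [Pi.add_apply, Pi.add_apply, h g hg, fusionAmplitude_add]
  rw [h3]
  ring

/-- Corrections that directly follow their fusions can be moved behind all fusions. -/
theorem run_interleavedFusionCommands {lt : V ⊕ F → V ⊕ F → Prop} (h : N.IsXYFlow p lt)
    (k : V ⊕ F → ZMod 2) (fs : List F) (hfs : fs.Nodup)
    (hY : fs.Pairwise fun f g => N.fusionLabel g = .Y → .inr g ∉ p (N.fusionNode f)) {X : Type*}
    (A : Matrix (V → Fin 2) X ℂ) :
    run k (N.interleavedFusionCommands p fs) A = run k (N.fusionCommands p fs) A := by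
  induction fs generalizing A with
  | nil => rfl
  | cons f fs ih =>
    rw [List.nodup_cons] at hfs
    rw [List.pairwise_cons] at hY
    have hodd : ∀ g ∈ fs, .inr g ∉ oddNbhd N.targetGraph (p (N.fusionNode f)) := by
      intro g hg
      have hne : N.fusionNode f ≠ N.fusionNode g := fun h => by
        obtain rfl : f = g := Sum.inr_injective (congrArg Subtype.val h)
        exact hfs.1 hg
      cases hl : N.fusionLabel g
      · exact h.fusion_X g hl _ hne
      · exact fun hg' => hY.1 g hg hl ((h.fusion_Y g hl _ hne).2 hg')
    rw [interleavedFusionCommands, List.flatMap_cons, run_append]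
    refine (ih hfs.2 hY.2 _).trans ?_
    rw [fusionCommands, fusionCommands, run_append, run_append, run_cons,
      run_fuse_corrections k _ fs hodd, List.map_cons, run_cons, List.flatMap_cons, run_append]

/-! ### Determinism -/

/-- Determinism for every initial part `C` which acts like the preparation, fusions and fusion
corrections, contains no measurement, and can be run with all qubits left alive. -/
theorem deterministicallyImplements_of_run_eq {lt : V ⊕ F → V ⊕ F → Prop}
    (h : N.IsXYFlow p lt) (fs : List F) (hfs : fs.Nodup) (hfs' : ∀ f, f ∈ fs)
    (vs : List {v // v ∉ N.O}) (hvs : vs.Nodup) (hvs' : ∀ v, v ∈ vs)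
    (hlt : vs.Pairwise fun v w => ¬ lt (.inl w.1) (.inl v.1)) (C : List (Command V F))
    (hC : ∀ k, run k C (embed N.I) =
      run k (N.preparationCommands ++ N.fusionCommands p fs) (embed N.I))
    (hm : ∀ c ∈ C, ∀ i l α, c ≠ .measure i l α)
    (hr : ∀ cs, (∀ known, RunnableFrom N.I N.O Finset.univ ∅ known cs) →
      RunnableFrom N.I N.O N.I ∅ ∅ (C ++ cs)) :
    Pattern.DeterministicallyImplements
      { I := N.I, O := N.O, commands := C ++ N.measurementCommands p vs } N.targetMap := by
  -- The truncated pattern which measures only `vs₁`, for arbitrary angles.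
  have key : ∀ (θ : V → ℝ) (vs₁ vs₂ : List {v // v ∉ N.O}), vs = vs₁ ++ vs₂ → ∀ k,
      ∃ c : ℂ, ‖c‖ = 1 ∧
        run k (C ++ N.measurementSteps p θ ((vs₂.map Subtype.val).toFinset ∪ N.O) vs₁)
          (embed N.I) =
        c • partialState ((vs₂.map Subtype.val).toFinset ∪ N.O) (N.nodeBra θ 0)
          N.targetState := by
    rintro θ vs₁ vs₂ rfl k
    rw [List.nodup_append] at hvs
    obtain ⟨hvs₁, -, hd⟩ := hvs
    have := exists_run_measurementSteps h θ k fs hfs hfs'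
      (R := (vs₂.map Subtype.val).toFinset ∪ N.O) Finset.subset_union_right vs₁ hvs₁
      (fun v => by
        have h1 := hvs' v
        rw [List.mem_append] at h1
        have h2 : v ∈ vs₁ ↔ v ∉ vs₂ :=
          ⟨fun h h' => hd v h v h' rfl, fun h => h1.resolve_right h⟩
        simp [h2, v.2])
      (List.pairwise_append.1 hlt).1
    rwa [run_append, ← hC, ← run_append] at this
  have key' : ∀ (θ : V → ℝ) (k : V ⊕ F → ZMod 2), ∃ c : ℂ, ‖c‖ = 1 ∧
      run k (C ++ N.measurementSteps p θ N.O vs) (embed N.I) =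
        c • partialState N.O (N.nodeBra θ 0) N.targetState := by
    intro θ k
    simpa using key θ vs [] (by simp) k
  have ratio : ∀ (Q : Pattern V F) (B : Matrix (V → Fin 2) ({v // v ∈ Q.I} → Fin 2) ℂ),
      (∀ k, ∃ c : ℂ, ‖c‖ = 1 ∧ Q.branch k = c • B) → Q.IsStronglyDeterministic := by
    intro Q B hQ k k'
    obtain ⟨c, hc, h⟩ := hQ k
    obtain ⟨c', hc', h'⟩ := hQ k'
    have hne : c' ≠ 0 := norm_ne_zero_iff.1 (by simp [hc'])
    refine ⟨c * c'⁻¹, by simp [hc, hc'], ?_⟩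
    rw [h, h', smul_smul, inv_mul_cancel_right₀ hne]
  have det : ∀ Q : Pattern V F, Q.IsStronglyDeterministic → Q.IsDeterministic := by
    intro Q hQ k k'
    obtain ⟨c, hc, h⟩ := hQ k k'
    exact ⟨c, norm_ne_zero_iff.1 (by simp [hc]), h⟩
  rw [measurementCommands_eq_measurementSteps]
  refine ⟨?_, fun θ => ?_, ?_, ?_, fun k => ?_⟩
  · refine hr _ fun known => ?_
    have : (vs.map Subtype.val).toFinset ∪ N.O = Finset.univ := by
      ext v
      by_cases hv : v ∈ N.O <;> simp [hv, hvs']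
    rw [← this, ← measurementCommands_eq_measurementSteps]
    exact runnableFrom_measurementCommands vs hvs _ _
  · refine det _ (ratio _ (partialState N.O (N.nodeBra θ 0) N.targetState) fun k => ?_)
    have := key' θ k
    rwa [← map_withAngles_measurementSteps θ N.totalAngle, ← map_withAngles_of_forall_ne θ C hm,
      ← List.map_append] at this
  · exact ratio _ _ (key' N.totalAngle)
  · intro pre post i l α hpre
    obtain ⟨pre', rfl, hpre'⟩ := exists_of_append_eq_append_cons
      (fun hc => hm _ hc i l α rfl) hpre
    obtain ⟨vs₁, v, vs₂, rfl, ht⟩ := exists_truncation _ _ vs hvs hpre'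
    refine det _ (ratio _ (partialState ((vs₂.map Subtype.val).toFinset ∪ N.O)
      (N.nodeBra N.totalAngle 0) N.targetState) fun k => ?_)
    have := key N.totalAngle (vs₁ ++ [v]) vs₂ (by simp) k
    rw [← ht (outcomes (C ++ pre')), ← List.append_assoc] at this
    exact this
  · obtain ⟨c, hc, h⟩ := key' N.totalAngle k
    rw [partialState_eq_embed_mul_targetMap] at h
    exact ⟨c, norm_ne_zero_iff.1 (by simp [hc]), h⟩

end XYFusionNetwork

end XYFusion

end

theorem mainTheorem2 {V F : Type*} [Fintype V] [DecidableEq V] [Fintype F] [DecidableEq F]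
    (N : XYFusion.XYFusionNetwork V F)
    (p : {n // n ∉ N.targetOpenGraph.O} → Finset (V ⊕ F)) (lt : V ⊕ F → V ⊕ F → Prop)
    (hflow : N.IsXYFlow p lt)
    -- any order of the fusions
    (fs : List F) (hfs : fs.Nodup) (hfs' : ∀ f, f ∈ fs)
    -- any order of the single-qubit measurements that is compatible with the flow
    (vs : List {v // v ∉ N.O}) (hvs : vs.Nodup) (hvs' : ∀ v, v ∈ vs)
    (hlt : vs.Pairwise fun v w => ¬ lt (.inl w.1) (.inl v.1)) :
    (N.flowPattern p fs vs).DeterministicallyImplements N.targetMap ∧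
    -- the corrections of a fusion may also directly follow it, unless its correction
    -- set contains the node of a later Y-fusion
    ((fs.Pairwise fun f g => N.fusionLabel g = .Y → .inr g ∉ p (N.fusionNode f)) →
      (N.interleavedFlowPattern p fs vs).DeterministicallyImplements N.targetMap) := by
  open XYFusion XYFusionNetwork in
  refine ⟨deterministicallyImplements_of_run_eq hflow fs hfs hfs' vs hvs hvs' hlt _
    (fun _ => rfl) (fun c hc => ?_) (fun cs hcs => ?_), fun hY =>
      deterministicallyImplements_of_run_eq hflow fs hfs hfs' vs hvs hvs' hlt _
    (fun k => ?_) (fun c hc => ?_) (fun cs hcs => ?_)⟩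
  · rcases List.mem_append.1 hc with hc | hc
    · exact ne_measure_of_mem_preparationCommands hc
    · exact ne_measure_of_mem_fusionCommands hc
  · rw [List.append_assoc]
    exact runnableFrom_preparationCommands (runnableFrom_fusionCommands fs hfs hcs)
  · rw [run_append, run_append, run_interleavedFusionCommands hflow k fs hfs hY]
  · rcases List.mem_append.1 hc with hc | hc
    · exact ne_measure_of_mem_preparationCommands hc
    · exact ne_measure_of_mem_interleavedFusionCommands hc
  · rw [List.append_assoc]
    exact runnableFrom_preparationCommands
      (runnableFrom_interleavedFusionCommands fs hfs hcs ∅ (by simp))
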